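/- Let $H\neq\{0\}$ be a real Hilbert space, $r>0$, $T>0$, and let $Z\subseteq H$ be closed and $r$-prox-regular: writing $d_Z(v)=\inf_{s\in Z}\|v-s\|$ and $\mathrm{Proj}_Z(v)=\{x\in Z:\|x-v\|=d_Z(v)\}$, for every $v\in H$ with $0<d_Z(v)<r$ one has $\mathrm{Proj}_Z(v)\neq\varnothing$ and $x\in \mathrm{Proj}_Z\bigl(x+r\frac{v-x}{\|v-x\|}\bigr)$ for all $x\in\mathrm{Proj}_Z(v)$. For an input $u\in C([0,T];H)\cap BV([0,T];H)$ and an initial datum $z_0\in Z$, a solution of the play problem is a function $y\in C([0,T];H)\cap BV([0,T];H)$ such that $u(t)-y(t)\in Z$ for all $t\in[0,T]$, $u(0)-y(0)=z_0$, and $$\int_{[0,T]}\langle z(t)-u(t)+y(t),\,dDy(t)\rangle\le\frac1{2r}\int_{[0,T]}\|z(t)-u(t)+y(t)\|^2\,d|Dy|(t)$$ for every $z\in BV([0,T];H)$ with $z([0,T])\subseteq Z$, where $Dy$ is the differential (Lebesgue–Stieltjes) measure of $y$ and $|Dy|$ its total variation. **Theorem.** For every Lipschitz input $u:[0,T]\to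 H$ and every $z_0\in Z$ the play problem has exactly one solution $y=:P(u,z_0)$; it is Lipschitz continuous, and differentiable almost everywhere on $[0,T]$. Moreover, the resulting (non-convex) play operator $P$ on Lipschitz inputs is continuous with respect to the $BV$-norm $\|f\|_\infty+\int_0^T\|f'(t)\|\,dt$: let $u,u_n:[0,T]\to H$ be Lipschitz continuous and $z_0,z_{0n}\in Z$ ($n\in\mathbb N$), with no uniform bound assumed on the Lipschitz constants of the $u_n$, and put $y=P(u,z_0)$, $y_n=P(u_n,z_{0n})$. If $\|z_0-z_{0n}\|\to0$ and $$\|u-u_n\|_\infty+\|u'-u_n'\|_{L^1([0,T];H)}\to0\qquad(n\to\infty),$$ then $$\|y-y_n\|_\infty+\|y'-y_n'\|_{L^1([0,T];H)}\to0\qquad(n\to\infty).$$ -/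

import Mathlib

open Set MeasureTheory Filter Topology
open scoped ENNReal NNReal

noncomputable section

namespace ProxPlay

/-- The extension of `f` from `[0, T]` to the real line by the constants `f 0` on the left and
`f T` on the right. It depends only on the restriction of `f` to `[0, T]`. -/
def constExtend {E : Type*} {T : ℝ} (hT : 0 ≤ T) (f : ℝ → E) : ℝ → E :=
  fun t => f (projIcc 0 T hT t)

lemma boundedVariationOn_constExtend {E : Type*} [NormedAddCommGroup E] {T : ℝ} (hT : 0 ≤ T)
    {f : ℝ → E}
    (hf : BoundedVariationOn f (Icc 0 T)) : BoundedVariationOn (constExtend hT f) univ := by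
  have h : eVariationOn (f ∘ fun t => (projIcc 0 T hT t : ℝ)) univ ≤ eVariationOn f (Icc 0 T) :=
    eVariationOn.comp_le_of_monotoneOn f _
      (fun _ _ _ _ hab => monotone_projIcc hT hab) (fun t _ => (projIcc 0 T hT t).2)
  exact ne_top_of_le_ne_top hf h

variable {H : Type*} [NormedAddCommGroup H] [InnerProductSpace ℝ H]

/-- The set of projections (nearest points) of `y` onto `K`. -/
def proj (K : Set H) (y : H) : Set H :=
  {x | x ∈ K ∧ ‖x - y‖ = Metric.infDist y K}

/-- `K` is closed and `r`-prox-regular: every `y` with `0 < d_K(y) < r` has a projection, and each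
of its projections `x` is also a projection of the point at distance `r` from `x` on the half-line
from `x` through `y`. -/
structure IsProxRegular (r : ℝ) (K : Set H) : Prop where
  isClosed : IsClosed K
  nonempty_proj : ∀ y : H, 0 < Metric.infDist y K → Metric.infDist y K < r → (proj K y).Nonempty
  mem_proj : ∀ y : H, 0 < Metric.infDist y K → Metric.infDist y K < r →
    ∀ x ∈ proj K y, x ∈ proj K (x + (r / ‖y - x‖) • (y - x))

/-- The differential measure `Df` of a function `f` of bounded variation on `[0, T]`: the
(Lebesgue--Stieltjes) vector measure on the real line, concentrated on `[0, T]`, of the constant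
extension of `f`. -/
def differentialMeasure [CompleteSpace H] {T : ℝ} (hT : 0 ≤ T) {f : ℝ → H}
    (hf : BoundedVariationOn f (Icc 0 T)) : VectorMeasure ℝ H :=
  (boundedVariationOn_constExtend hT hf).vectorMeasure

/-- `y` solves the (non-convex) play problem on `[0, T]` with characteristic set `Z`, constant `r`,
input `u` and initial datum `z₀`. Functions on `[0, T]` are represented by functions on the real
line, of which only the values on `[0, T]` matter. -/
structure IsPlaySolution [CompleteSpace H] {T : ℝ} (hT : 0 ≤ T) (r : ℝ) (Z : Set H)
    (u : ℝ → H) (z₀ : H) (y : ℝ → H) : Prop where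
  continuousOn : ContinuousOn y (Icc 0 T)
  boundedVariationOn : BoundedVariationOn y (Icc 0 T)
  sub_mem : ∀ t ∈ Icc 0 T, u t - y t ∈ Z
  /-- `∫ ⟨z - u + y, dDy⟩ ≤ (1 / 2r) ∫ ‖z - u + y‖² d|Dy|` over `[0, T]`, for all `Z`-valued
  functions `z` of bounded variation. -/
  variational : ∀ z : ℝ → H, BoundedVariationOn z (Icc 0 T) → (∀ t ∈ Icc 0 T, z t ∈ Z) →
    (∫ᵛ t in Icc 0 T, (z t - u t + y t) ∂[innerSL ℝ;
        differentialMeasure hT boundedVariationOn])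
      ≤ 1 / (2 * r) * ∫ t in Icc 0 T, ‖z t - u t + y t‖ ^ 2
          ∂(differentialMeasure hT boundedVariationOn).variation
  initial : u 0 - y 0 = z₀

/-- The play operator `P(u, z₀)`: the solution of the play problem with input `u` and initial
datum `z₀` (unique on `[0, T]`; some function if there is no solution). -/
def play [CompleteSpace H] {T : ℝ} (hT : 0 ≤ T) (r : ℝ) (Z : Set H) (u : ℝ → H) (z₀ : H) : ℝ → H :=
  Classical.epsilon (IsPlaySolution hT r Z u z₀)

/-- `Lip([0, T]; H)`. -/
def IsLip (T : ℝ) (f : ℝ → H) : Prop :=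
  ∃ L : ℝ≥0, LipschitzOnWith L f (Icc 0 T)

/-- The distance `‖f - g‖_∞ + ‖f' - g'‖_{L¹}` on `[0, T]`, for functions `f`, `g` that are
differentiable almost everywhere on `[0, T]`. -/
def wDist (T : ℝ) (f g : ℝ → H) : ℝ≥0∞ :=
  (⨆ t ∈ Icc 0 T, ‖f t - g t‖ₑ) +
    eLpNorm (fun t => deriv f t - deriv g t) 1 (volume.restrict (Icc 0 T))

end ProxPlay

end

/-!
# The play operator with prox-regular characteristic set

For Lipschitz inputs the play problem is equivalent to the pointwise inclusion that `y'(t)` is a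
proximal normal to `Z` at `x(t) = u(t) - y(t)`, with the uniform constant `‖y'(t)‖ / (2r)`; this is
`IsStrongSolution`.

*Uniqueness.* Let `ν` be the sum of the variations of the differential measures of two solutions.
Hilbert spaces have the Radon–Nikodym property (`exists_eq_withDensityᵥ`, from the Riesz
representation theorem in `L²(ν; H)`), so both measures have densities with respect to `ν`. Testing
each variational inequality with the other solution, the chain rule for `‖y₁ - y₂‖²` and Grönwall's
inequality for the atomless measure `ν` give `y₁ = y₂` (`IsPlaySolution.eqOn`).

*Existence.* Moreau's catching-up algorithm projects the translated point onto `Z` at each time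
step. Prox-regularity makes the steps proximal normals with a uniform constant, so the polygonal
curves are approximate solutions whose mutual distances are controlled by Grönwall's inequality
(`IsApproxSolution.norm_sub_sq_le`). The limit satisfies the normal inequality with some constant,
and prox-regularity improves this constant to `‖y'‖ / (2r)`
(`IsProxRegular.inner_le_of_forall_inner_le`).

*Continuity.* At almost every time `x` moves inside `Z` with velocity `u' - y'`, and a proximal
normal is orthogonal to a two-sided tangent direction; hence `⟪y', u' - y'⟫ = 0`
(`IsStrongSolution.ae_inner_deriv_eq_zero`). This has two consequences. First, `‖y'‖ ≤ ‖u'‖`, so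
that the Grönwall constant in the comparison of two solutions only involves the `L¹` norms of the
derivatives of the inputs, and `u - y` depends continuously on the data in the supremum norm
(`IsStrongSolution.norm_sub_sq_le`). Secondly, the reflected velocity `u' - 2y'` has the same norm
as `u'`. So the norms of the reflected velocities converge in `L¹`, while their integrals over
intervals converge because the functions converge uniformly; by a Radon–Riesz argument
(`tendsto_integral_norm_sub_zero`) the reflected velocities converge strongly in `L¹`, and then so
do the velocities.
-/

set_option linter.unusedSectionVars false

namespace ProxPlay

/-! ### Vector measures on the line -/

section VectorMeasures

variable {E : Type*} [NormedAddCommGroup E]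

/-- Vector measures on the line that agree on bounded intervals are equal; the whole line, which is
not in the generating semiring, is exhausted by intervals. -/
lemma vectorMeasure_ext_Ioc {m m' : VectorMeasure ℝ E}
    (h : ∀ a b, a ≤ b → m (Ioc a b) = m' (Ioc a b)) : m = m' := by
  have hU : (univ : Set ℝ) = ⋃ n : ℕ, Ioc (-(n : ℝ)) n := by
    refine (eq_univ_of_forall fun x => ?_).symm
    obtain ⟨n, hn⟩ := exists_nat_gt |x|
    exact mem_iUnion.2 ⟨n, (abs_lt.1 hn).1, (abs_lt.1 hn).2.le⟩
  have hmono : Monotone fun n : ℕ => Ioc (-(n : ℝ)) n := fun i j hij => by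
    have : (i : ℝ) ≤ j := by exact_mod_cast hij
    exact Ioc_subset_Ioc (by linarith) this
  refine VectorMeasure.ext_of_generateFrom {s | ∃ u v : ℝ, u ≤ v ∧ s = Ioc u v} ?_ ?_ ?_ ?_
  · rintro s ⟨u, v, huv, rfl⟩
    exact h u v huv
  · have := borel_eq_generateFrom_Ioc_le ℝ
    rw [← BorelSpace.measurable_eq (α := ℝ)] at this
    convert! this using 2
    grind only
  · exact IsSetSemiring.Ioc.isPiSystem
  · have h1 := m.tendsto_vectorMeasure_iUnion_atTop_nat hmono (fun _ => measurableSet_Ioc)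
    have h2 := m'.tendsto_vectorMeasure_iUnion_atTop_nat hmono (fun _ => measurableSet_Ioc)
    rw [← hU] at h1 h2
    refine tendsto_nhds_unique h1 (h2.congr fun n => (h _ _ ?_).symm)
    have : (0 : ℝ) ≤ n := n.cast_nonneg
    linarith

/-- Domination of a vector measure by a finite measure can be checked on intervals: the extension
theorem for dominated additive contents yields a dominated measure, which has to be the given
one. -/
lemma enorm_vectorMeasure_le_of_Ioc [CompleteSpace E] {m : VectorMeasure ℝ E} {ν : Measure ℝ}
    [IsFiniteMeasure ν] (h : ∀ a b, a ≤ b → ‖m (Ioc a b)‖ₑ ≤ ν (Ioc a b)) (s : Set ℝ) :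
    ‖m s‖ₑ ≤ ν s := by
  have hF : ∀ a b : ℝ, a ≤ b → m (Ioc a b) = m (Iic b) - m (Iic a) := fun a b hab => by
    rw [← Iic_union_Ioc_eq_Iic hab, VectorMeasure.of_union (Iic_disjoint_Ioc le_rfl)
      measurableSet_Iic measurableSet_Ioc]
    abel
  have hgen : (inferInstance : MeasurableSpace ℝ) =
      MeasurableSpace.generateFrom {s | ∃ u v : ℝ, u ≤ v ∧ s = Ioc u v} := by
    have := borel_eq_generateFrom_Ioc_le ℝ
    rw [← BorelSpace.measurable_eq (α := ℝ)] at this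
    convert! this using 2
    grind only
  obtain ⟨m', hm', hle⟩ :=
    VectorMeasure.exists_extension_of_isSetSemiring_of_le_measure_of_generateFrom
      (m := AddContent.onIoc fun t => m (Iic t)) (μ := ν) IsSetSemiring.Ioc (by
        rintro s ⟨u, v, huv, rfl⟩
        rw [AddContent.onIoc_apply huv, ← hF u v huv]
        exact h u v huv) hgen
  have : m = m' := vectorMeasure_ext_Ioc fun a b hab => by
    rw [hm' _ ⟨a, b, hab, rfl⟩, AddContent.onIoc_apply hab, hF a b hab]
  rw [this]
  exact hle s

lemma isFiniteMeasure_variation_vectorMeasure [CompleteSpace E] {f : ℝ → E}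
    (hf : BoundedVariationOn f univ) : IsFiniteMeasure hf.vectorMeasure.variation := by
  have : IsFiniteMeasure (hf.stieltjesFunctionRightLim 0).measure :=
    StieltjesFunction.isFiniteMeasure_of_forall_abs_le
      (C := (eVariationOn f.rightLim univ).toReal) _
      (fun x ↦ variationOnFromTo.abs_le_eVariationOn hf.rightLim)
  refine isFiniteMeasure_of_le (hf.stieltjesFunctionRightLim 0).measure
    (VectorMeasure.variation_le_of_forall_enorm_le fun s _ =>
      enorm_vectorMeasure_le_of_Ioc (fun u v huv => ?_) s)
  rw [hf.vectorMeasure_Ioc huv]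
  simp only [StieltjesFunction.measure_Ioc, BoundedVariationOn.stieltjesFunctionRightLim_apply]
  rw [← variationOnFromTo.add hf.rightLim.locallyBoundedVariationOn
    (mem_univ 0) (mem_univ u) (mem_univ v)]
  simp only [add_sub_cancel_left, variationOnFromTo, huv, ↓reduceIte, univ_inter]
  rw [ENNReal.ofReal_toReal
    ((eVariationOn.mono _ (subset_univ _)).trans_lt hf.rightLim.lt_top).ne,
    ← edist_eq_enorm_sub]
  exact eVariationOn.edist_le _ (by grind) (by grind)

end VectorMeasures

/-! ### The Radon–Nikodym property of Hilbert spaces -/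

section RadonNikodym

variable {X : Type*} [MeasurableSpace X]
  {H : Type*} [NormedAddCommGroup H] [InnerProductSpace ℝ H] [CompleteSpace H]

/-- The Radon–Nikodym property of Hilbert spaces: the density represents the functional
`φ ↦ ∫ ⟨φ, dm⟩` on `L²(ν; H)`. -/
lemma exists_eq_withDensityᵥ (m : VectorMeasure X H) (ν : Measure X) [IsFiniteMeasure ν]
    (h : m.variation ≤ ν) : ∃ g : X → H, StronglyMeasurable g ∧ Integrable g ν ∧
      m = ν.withDensityᵥ g := by
  have hfin : IsFiniteMeasure m.variation := isFiniteMeasure_of_le ν h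
  have hint : ∀ φ : Lp H 2 ν, Integrable φ ν := fun φ =>
    (Lp.memLp φ).integrable (by norm_num)
  have hint' : ∀ φ : Lp H 2 ν, m.Integrable φ := fun φ => (hint φ).mono_measure h
  have hac : m.variation ≪ ν := Measure.absolutelyContinuous_of_le h
  let Φ₀ : Lp H 2 ν →ₗ[ℝ] ℝ :=
    { toFun := fun φ => ∫ᵛ x, φ x ∂[innerSL ℝ; m]
      map_add' := fun φ ψ => by
        rw [← VectorMeasure.integral_add (hint' φ) (hint' ψ)]
        exact VectorMeasure.integral_congr_ae (hac.ae_le (Lp.coeFn_add φ ψ))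
      map_smul' := fun c φ => by
        rw [RingHom.id_apply, ← VectorMeasure.integral_smul]
        exact VectorMeasure.integral_congr_ae (hac.ae_le (Lp.coeFn_smul c φ)) }
  have hbound : ∀ φ : Lp H 2 ν, ‖Φ₀ φ‖ ≤
      (‖innerSL (E := H) ℝ‖ * (ν univ ^ (1 / 2 : ℝ)).toReal) * ‖φ‖ := fun φ => by
    calc ‖Φ₀ φ‖ ≤ ‖innerSL (E := H) ℝ‖ * ∫ x, ‖φ x‖ ∂m.variation :=
          VectorMeasure.norm_integral_le_integral_norm
      _ ≤ ‖innerSL (E := H) ℝ‖ * ∫ x, ‖φ x‖ ∂ν := by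
          refine mul_le_mul_of_nonneg_left ?_ (by positivity)
          exact integral_mono_measure h (by filter_upwards with x; simp) (hint φ).norm
      _ ≤ ‖innerSL (E := H) ℝ‖ * ((ν univ ^ (1 / 2 : ℝ)).toReal * ‖φ‖) := by
          gcongr
          rw [integral_norm_eq_lintegral_enorm (hint φ).1, ← eLpNorm_one_eq_lintegral_enorm,
            Lp.norm_def, ← ENNReal.toReal_mul]
          refine ENNReal.toReal_mono (ENNReal.mul_ne_top (by finiteness) (Lp.memLp φ).2.ne) ?_
          rw [mul_comm]
          refine (eLpNorm_le_eLpNorm_mul_rpow_measure_univ (p := 1) (q := 2) (by norm_num)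
            (Lp.memLp φ).1).trans (le_of_eq ?_)
          norm_num
      _ = _ := by ring
  let Φ := Φ₀.mkContinuous _ hbound
  let G : Lp H 2 ν := (InnerProductSpace.toDual ℝ (Lp H 2 ν)).symm Φ
  have hG : ∀ φ : Lp H 2 ν, ∫ x, inner ℝ (G x) (φ x) ∂ν = ∫ᵛ x, φ x ∂[innerSL ℝ; m] := fun φ => by
    rw [← L2.inner_def, InnerProductSpace.toDual_symm_apply]
    rfl
  refine ⟨G, Lp.stronglyMeasurable G, hint G, ?_⟩
  ext s hs
  rw [withDensityᵥ_apply (hint G) hs]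
  refine ext_inner_left ℝ fun c => ?_
  have hμs : ν s ≠ ∞ := by finiteness
  -- testing with constants on `s` recovers `m s`
  have h1 := hG (indicatorConstLp 2 hs hμs c)
  have h2 : ∫ᵛ x, (indicatorConstLp 2 hs hμs c : Lp H 2 ν) x ∂[innerSL ℝ; m] = inner ℝ c (m s) := by
    rw [VectorMeasure.integral_congr_ae (hac.ae_le indicatorConstLp_coeFn),
      VectorMeasure.integral_indicator hs]
    have : IsFiniteMeasure (m.restrict s).variation := by
      rw [VectorMeasure.variation_restrict hs]; infer_instance
    rw [VectorMeasure.integral_const, VectorMeasure.restrict_apply _ hs MeasurableSet.univ,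
      univ_inter, innerSL_apply_apply]
  rw [← h2, ← h1, ← integral_inner (hint G).integrableOn, ← integral_indicator hs]
  refine integral_congr_ae ?_
  filter_upwards [indicatorConstLp_coeFn (p := 2) (hs := hs) (hμs := hμs) (c := c)] with x hx
  rw [hx]
  by_cases hxs : x ∈ s <;> simp [hxs, real_inner_comm]

lemma integrable_inner_of_integrable_withDensity {ν : Measure X} {g φ : X → H}
    (hg : StronglyMeasurable g) (hφ : Integrable φ (ν.withDensity fun x => ‖g x‖ₑ)) :
    Integrable (fun x => inner ℝ (φ x) (g x)) ν := by
  have hgm : Measurable fun x => ‖g x‖ₑ := hg.enorm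
  obtain ⟨ψ, hψ, hφψ⟩ := hφ.1
  have h0 : (fun x => inner ℝ (φ x) (g x)) =ᵐ[ν] fun x => inner ℝ (ψ x) (g x) := by
    have := (ae_withDensity_iff hgm).1 hφψ
    filter_upwards [this] with x hx
    by_cases hgx : g x = 0
    · simp [hgx]
    · rw [hx (by simpa using hgx)]
  refine (Integrable.congr ⟨(hψ.inner hg).aestronglyMeasurable, ?_⟩ h0.symm)
  have h1 : HasFiniteIntegral ψ (ν.withDensity fun x => ‖g x‖ₑ) := (hφ.congr hφψ).2
  rw [hasFiniteIntegral_iff_enorm,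
    lintegral_withDensity_eq_lintegral_mul _ hgm hψ.enorm] at h1
  rw [hasFiniteIntegral_iff_enorm]
  refine (lintegral_mono fun x => ?_).trans_lt h1
  simp only [Pi.mul_apply, ← ofReal_norm]
  rw [← ENNReal.ofReal_mul (norm_nonneg _), mul_comm]
  exact ENNReal.ofReal_le_ofReal (by simpa using norm_inner_le_norm (𝕜 := ℝ) (ψ x) (g x))

/-- The integral of `φ` against the vector measure with density `g` is the integral of
`⟪φ, g⟫`. -/
lemma integral_innerSL_withDensityᵥ {ν : Measure X} {g φ : X → H}
    (hg : StronglyMeasurable g) (hgi : Integrable g ν)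
    (hφ : Integrable φ (ν.withDensity fun x => ‖g x‖ₑ)) :
    ∫ᵛ x, φ x ∂[innerSL ℝ; ν.withDensityᵥ g] = ∫ x, inner ℝ (φ x) (g x) ∂ν := by
  have hvar := Measure.variation_withDensityᵥ hgi
  have hgm : Measurable fun x => ‖g x‖ₑ := hg.enorm
  have hfin : IsFiniteMeasure (ν.withDensityᵥ g).variation := by
    rw [hvar]
    exact isFiniteMeasure_withDensity hgi.2.ne
  rw [← hvar] at hφ
  have hI : ∀ {φ : X → H}, Integrable φ (ν.withDensityᵥ g).variation →
      Integrable (fun x => inner ℝ (φ x) (g x)) ν := fun h =>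
    integrable_inner_of_integrable_withDensity hg (hvar ▸ h)
  have hle : ∀ {φ : X → H}, Integrable φ (ν.withDensityᵥ g).variation →
      ‖∫ x, inner ℝ (φ x) (g x) ∂ν‖ ≤ ∫ x, ‖φ x‖ ∂(ν.withDensityᵥ g).variation := fun {φ} h => by
    rw [hvar] at h ⊢
    rw [integral_withDensity_eq_integral_toReal_smul hgm (by simp)]
    refine (norm_integral_le_integral_norm _).trans (integral_mono_of_nonneg
      (by filter_upwards with x; simp) ?_ ?_)
    · have := h.norm
      rw [integrable_withDensity_iff_integrable_smul' hgm (by simp)] at this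
      exact this
    · filter_upwards with x
      rw [smul_eq_mul, toReal_enorm, mul_comm]
      exact norm_inner_le_norm _ _
  refine Integrable.induction (fun φ : X → H => ∫ᵛ x, φ x ∂[innerSL ℝ; ν.withDensityᵥ g] =
    ∫ x, inner ℝ (φ x) (g x) ∂ν) ?_ ?_ ?_ ?_ hφ
  · intro c s hs hμs
    rw [VectorMeasure.integral_indicator hs]
    have : IsFiniteMeasure ((ν.withDensityᵥ g).restrict s).variation := by
      rw [VectorMeasure.variation_restrict hs]; infer_instance
    rw [VectorMeasure.integral_const, VectorMeasure.restrict_apply _ hs MeasurableSet.univ,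
      univ_inter, innerSL_apply_apply, withDensityᵥ_apply hgi hs, ← integral_inner hgi.integrableOn,
      ← integral_indicator hs]
    congr 1 with x
    by_cases hxs : x ∈ s <;> simp [hxs]
  · intro φ ψ _ hφ hψ h1 h2
    simp only [Pi.add_apply, inner_add_left]
    rw [VectorMeasure.integral_fun_add hφ hψ, h1, h2, integral_add (hI hφ) (hI hψ)]
  · show IsClosed _
    refine isClosed_eq VectorMeasure.continuous_integral ?_
    refine Metric.continuous_iff'.2 fun φ ε hε => ?_
    filter_upwards [Metric.ball_mem_nhds φ hε] with ψ hψ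
    refine lt_of_le_of_lt ?_ (Metric.mem_ball.1 hψ)
    have hi := L1.integrable_coeFn φ
    have hj := L1.integrable_coeFn ψ
    rw [dist_eq_norm, ← integral_sub (hI hj) (hI hi), L1.dist_eq_integral_dist]
    simp only [dist_eq_norm, ← inner_sub_left]
    exact hle (hj.sub hi)
  · intro φ ψ hφψ _ h
    rw [← VectorMeasure.integral_congr_ae hφψ, h]
    refine integral_congr_ae ?_
    rw [hvar] at hφψ
    filter_upwards [(ae_withDensity_iff hgm).1 hφψ] with x hx
    by_cases hgx : g x = 0
    · simp [hgx]
    · rw [hx (by simpa using hgx)]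

end RadonNikodym

/-! ### Differential measures of continuous functions -/

section DifferentialMeasure

variable {H : Type*} [NormedAddCommGroup H] {T : ℝ}

lemma constExtend_of_mem (hT : 0 ≤ T) (f : ℝ → H) {t : ℝ} (ht : t ∈ Icc 0 T) :
    constExtend hT f t = f t := by
  simp [constExtend, projIcc_of_mem hT ht]

lemma continuous_constExtend (hT : 0 ≤ T) {f : ℝ → H} (hf : ContinuousOn f (Icc 0 T)) :
    Continuous (constExtend hT f) :=
  hf.comp_continuous (continuous_subtype_val.comp continuous_projIcc) fun t =>
    (projIcc 0 T hT t).2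

variable [InnerProductSpace ℝ H] [CompleteSpace H]

lemma differentialMeasure_Ioc (hT : 0 ≤ T) {f : ℝ → H} (hf : BoundedVariationOn f (Icc 0 T))
    (hc : ContinuousOn f (Icc 0 T)) {a b : ℝ} (hab : a ≤ b) :
    differentialMeasure hT hf (Ioc a b) = constExtend hT f b - constExtend hT f a := by
  have hr : ∀ t, (constExtend hT f).rightLim t = constExtend hT f t := fun t =>
    rightLim_eq_of_tendsto
      ((continuous_constExtend hT hc).continuousAt.tendsto.mono_left nhdsWithin_le_nhds)
  rw [differentialMeasure, BoundedVariationOn.vectorMeasure_Ioc _ hab, hr, hr]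

lemma isFiniteMeasure_variation_differentialMeasure (hT : 0 ≤ T) {f : ℝ → H}
    (hf : BoundedVariationOn f (Icc 0 T)) :
    IsFiniteMeasure (differentialMeasure hT hf).variation :=
  isFiniteMeasure_variation_vectorMeasure _

lemma nullSingletonClass_variation_differentialMeasure (hT : 0 ≤ T) {f : ℝ → H}
    (hf : BoundedVariationOn f (Icc 0 T)) (hc : ContinuousOn f (Icc 0 T)) :
    NullSingletonClass (differentialMeasure hT hf).variation := by
  refine ⟨fun a => (VectorMeasure.variation_apply_eq_zero (measurableSet_singleton a)).2
    fun s hs _ => ?_⟩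
  rcases subset_singleton_iff_eq.1 hs with rfl | rfl
  · simp
  · have hr : (constExtend hT f).rightLim a = constExtend hT f a :=
      rightLim_eq_of_tendsto
        ((continuous_constExtend hT hc).continuousAt.tendsto.mono_left nhdsWithin_le_nhds)
    have hl : (constExtend hT f).leftLim a = constExtend hT f a :=
      leftLim_eq_of_tendsto
        ((continuous_constExtend hT hc).continuousAt.tendsto.mono_left nhdsWithin_le_nhds)
    rw [differentialMeasure, BoundedVariationOn.vectorMeasure_singleton, hr, hl, sub_self]

end DifferentialMeasure

/-! ### Lipschitz curves -/

section Lipschitz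

variable {H : Type*} [NormedAddCommGroup H] {T : ℝ} {L : ℝ≥0} {f : ℝ → H}

lemma _root_.LipschitzOnWith.boundedVariationOn_Icc (hf : LipschitzOnWith L f (Icc 0 T)) :
    BoundedVariationOn f (Icc 0 T) := by
  rcases lt_or_ge T 0 with h | hT
  · rw [Icc_eq_empty (not_le.2 h)]
    exact BoundedVariationOn.of_subsingleton subsingleton_empty
  · simpa using hf.locallyBoundedVariationOn 0 T ⟨le_rfl, hT⟩ ⟨hT, le_rfl⟩

variable [InnerProductSpace ℝ H] [CompleteSpace H]

/-- A Lipschitz curve in a Hilbert space is the primitive of its almost everywhere defined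
derivative, and its differential measure has that derivative as a density. -/
lemma exists_density_of_lipschitzOn (hT : 0 ≤ T) (hf : LipschitzOnWith L f (Icc 0 T)) :
    ∃ g : ℝ → H, StronglyMeasurable g ∧ Integrable g ∧ (∀ t ∉ Icc 0 T, g t = 0) ∧
      differentialMeasure hT hf.boundedVariationOn_Icc = volume.withDensityᵥ g ∧
      ∀ᵐ t, t ∈ Icc 0 T → HasDerivAt f (g t) t := by
  set m := differentialMeasure hT hf.boundedVariationOn_Icc with hm
  set lam := volume.restrict (Icc 0 T) with hlam
  have hIoc : ∀ a b, a ≤ b → m (Ioc a b) = constExtend hT f b - constExtend hT f a :=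
    fun a b hab => differentialMeasure_Ioc hT _ hf.continuousOn hab
  -- the constant `L + 1` is used in place of `L` because it is positive
  have hle : m.variation ≤ (L + 1) • lam := by
    refine VectorMeasure.variation_le_of_forall_enorm_le fun s _ =>
      enorm_vectorMeasure_le_of_Ioc (fun a b hab => ?_) s
    rw [hIoc a b hab, ← edist_eq_enorm_sub]
    refine (hf (projIcc 0 T hT b).2 (projIcc 0 T hT a).2).trans ?_
    rw [Measure.smul_apply, hlam, Measure.restrict_apply measurableSet_Ioc, ENNReal.smul_def,
      smul_eq_mul]
    refine mul_le_mul' (by simp) ?_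
    have hsub : Ioc (projIcc 0 T hT a : ℝ) (projIcc 0 T hT b) ⊆ Ioc a b ∩ Icc 0 T := by
      intro x hx
      rw [coe_projIcc, coe_projIcc] at hx
      grind
    refine le_trans ?_ (measure_mono hsub)
    rw [Real.volume_Ioc]
    refine (edist_dist (projIcc 0 T hT b) (projIcc 0 T hT a)).trans_le ?_
    rw [Subtype.dist_eq, Real.dist_eq,
      abs_of_nonneg (sub_nonneg.2 (Subtype.coe_le_coe.2 (monotone_projIcc hT hab)))]
  have hfin : IsFiniteMeasure ((L + 1) • lam) := by infer_instance
  obtain ⟨g₀, hg₀, hg₀i, hmg⟩ := exists_eq_withDensityᵥ m ((L + 1) • lam) hle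
  have hg₀l : Integrable g₀ lam := by
    have := hg₀i.smul_measure_nnreal (c := (L + 1)⁻¹)
    rwa [smul_smul, inv_mul_cancel₀ (by positivity), one_smul] at this
  set g : ℝ → H := (Icc 0 T).indicator fun t => (L + 1 : ℝ) • g₀ t with hg
  have hgi : Integrable g := by
    rw [hg, integrable_indicator_iff measurableSet_Icc]
    exact hg₀l.smul (L + 1 : ℝ)
  have hmg' : m = volume.withDensityᵥ g := by
    ext s hs
    rw [hmg, withDensityᵥ_apply hg₀i hs, withDensityᵥ_apply hgi hs, Measure.restrict_smul,
      integral_smul_nnreal_measure, hg, setIntegral_indicator measurableSet_Icc, integral_smul,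
      hlam, Measure.restrict_restrict hs, NNReal.smul_def]
    simp
  refine ⟨g, (hg₀.const_smul (L + 1 : ℝ)).indicator measurableSet_Icc, hgi,
    fun t ht => indicator_of_notMem ht _, hmg', ?_⟩
  have hne0 : ∀ᵐ t : ℝ, t ≠ 0 := by simp [ae_iff]
  have hneT : ∀ᵐ t : ℝ, t ≠ T := by simp [ae_iff]
  -- Lebesgue's differentiation theorem for the primitive of `g`
  filter_upwards [_root_.LocallyIntegrable.ae_hasDerivAt_integral hgi.locallyIntegrable, hne0, hneT]
    with t ht h0 h1 htT
  have hev : f =ᶠ[𝓝 t] fun s => f 0 + ∫ τ in (0 : ℝ)..s, g τ := by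
    filter_upwards [Ioo_mem_nhds (htT.1.lt_of_ne' h0) (htT.2.lt_of_ne h1)] with s hs
    have h2 := hIoc 0 s hs.1.le
    rw [hmg', withDensityᵥ_apply hgi measurableSet_Ioc,
      constExtend_of_mem hT f (Ioo_subset_Icc_self hs), constExtend_of_mem hT f ⟨le_rfl, hT⟩] at h2
    rw [intervalIntegral.integral_of_le hs.1.le, h2]
    abel
  exact ((ht 0).const_add (f 0)).congr_of_eventuallyEq hev

lemma ae_hasDerivAt_of_lipschitzOn (hT : 0 ≤ T) (hf : LipschitzOnWith L f (Icc 0 T)) :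
    ∀ᵐ t ∂volume.restrict (Icc 0 T), HasDerivAt f (deriv f t) t := by
  obtain ⟨g, -, -, -, -, hd⟩ := exists_density_of_lipschitzOn hT hf
  rw [ae_restrict_iff' measurableSet_Icc]
  filter_upwards [hd] with t ht hmem
  exact (ht hmem).differentiableAt.hasDerivAt

lemma ae_norm_deriv_le_of_lipschitzOn (hf : LipschitzOnWith L f (Icc 0 T)) :
    ∀ᵐ t ∂volume.restrict (Icc 0 T), ‖deriv f t‖ ≤ L := by
  have hne0 : ∀ᵐ t : ℝ, t ≠ 0 := by simp [ae_iff]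
  have hneT : ∀ᵐ t : ℝ, t ≠ T := by simp [ae_iff]
  rw [ae_restrict_iff' measurableSet_Icc]
  filter_upwards [hne0, hneT] with t h0 h1 htT
  exact norm_deriv_le_of_lipschitzOn
    (Icc_mem_nhds (htT.1.lt_of_ne' h0) (htT.2.lt_of_ne h1)) hf

lemma integrableOn_deriv_of_lipschitzOn (hT : 0 ≤ T) (hf : LipschitzOnWith L f (Icc 0 T)) :
    IntegrableOn (deriv f) (Icc 0 T) := by
  obtain ⟨g, -, hgi, -, -, hd⟩ := exists_density_of_lipschitzOn hT hf
  refine hgi.integrableOn.congr ?_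
  rw [EventuallyEq, ae_restrict_iff' measurableSet_Icc]
  filter_upwards [hd] with t ht hmem
  exact (ht hmem).deriv.symm

lemma integral_deriv_of_lipschitzOn (hT : 0 ≤ T) (hf : LipschitzOnWith L f (Icc 0 T)) {a b : ℝ}
    (ha : 0 ≤ a) (hab : a ≤ b) (hb : b ≤ T) : ∫ t in Ioc a b, deriv f t = f b - f a := by
  obtain ⟨g, -, hgi, -, hm, hd⟩ := exists_density_of_lipschitzOn hT hf
  have h2 := differentialMeasure_Ioc hT hf.boundedVariationOn_Icc hf.continuousOn hab
  rw [hm, withDensityᵥ_apply hgi measurableSet_Ioc,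
    constExtend_of_mem hT f ⟨ha.trans hab, hb⟩, constExtend_of_mem hT f ⟨ha, hab.trans hb⟩] at h2
  rw [← h2]
  refine setIntegral_congr_ae measurableSet_Ioc ?_
  filter_upwards [hd] with t ht hmem
  exact (ht ⟨ha.trans hmem.1.le, hmem.2.trans hb⟩).deriv

lemma variation_differentialMeasure_of_lipschitzOn (hT : 0 ≤ T)
    (hf : LipschitzOnWith L f (Icc 0 T)) (hbv : BoundedVariationOn f (Icc 0 T)) :
    (differentialMeasure hT hbv).variation =
      (volume.restrict (Icc 0 T)).withDensity fun t => ‖deriv f t‖ₑ := by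
  obtain ⟨g, -, hgi, h0, hm, hd⟩ := exists_density_of_lipschitzOn hT hf
  rw [hm, Measure.variation_withDensityᵥ hgi, ← withDensity_indicator measurableSet_Icc]
  refine withDensity_congr_ae ?_
  filter_upwards [hd] with t ht
  by_cases hmem : t ∈ Icc 0 T
  · rw [indicator_of_mem hmem, (ht hmem).deriv]
  · rw [indicator_of_notMem hmem, h0 t hmem, enorm_zero]

lemma integral_differentialMeasure_of_lipschitzOn (hT : 0 ≤ T)
    (hf : LipschitzOnWith L f (Icc 0 T)) (hbv : BoundedVariationOn f (Icc 0 T)) {φ : ℝ → H}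
    (hφ : Integrable φ (differentialMeasure hT hbv).variation) :
    ∫ᵛ t in Icc 0 T, φ t ∂[innerSL ℝ; differentialMeasure hT hbv] =
      ∫ t in Icc 0 T, inner ℝ (φ t) (deriv f t) := by
  obtain ⟨g, hg, hgi, h0, hm, hd⟩ := exists_density_of_lipschitzOn hT hf
  rw [← VectorMeasure.integral_indicator measurableSet_Icc]
  have hφ' := hφ.indicator (measurableSet_Icc (a := 0) (b := T))
  rw [hm, Measure.variation_withDensityᵥ hgi] at hφ'
  rw [hm, integral_innerSL_withDensityᵥ hg hgi hφ', ← integral_indicator measurableSet_Icc]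
  refine integral_congr_ae ?_
  filter_upwards [hd] with t ht
  by_cases hmem : t ∈ Icc 0 T
  · simp only [indicator_of_mem hmem, (ht hmem).deriv]
  · simp [indicator_of_notMem hmem]

end Lipschitz

/-! ### Chain rule and Grönwall inequality for integrals against a measure -/

section Gronwall

variable {T : ℝ} {ν : Measure ℝ}

lemma _root_.IntervalIntegrable.mono_Icc {E : Type*} [NormedAddCommGroup E] {f : ℝ → E}
    (hf : IntervalIntegrable f ν 0 T) {a b : ℝ} (ha : 0 ≤ a) (hab : a ≤ b) (hb : b ≤ T) :
    IntervalIntegrable f ν a b := by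
  refine hf.mono_set ?_
  rw [uIcc_of_le hab, uIcc_of_le (ha.trans (hab.trans hb))]
  exact Icc_subset_Icc ha hb

/-- A function whose increments over short intervals are `o(1)` times those of another function
is constant. -/
lemma eq_of_locally_abs_sub_le {G K : ℝ → ℝ} (hT : 0 ≤ T)
    (h : ∀ ε > 0, ∃ δ > 0, ∀ a b, 0 ≤ a → a ≤ b → b ≤ T → b - a < δ →
      |G b - G a| ≤ ε * (K b - K a)) : G T = G 0 := by
  have key : ∀ ε > 0, |G T - G 0| ≤ ε * (K T - K 0) := by
    intro ε hε
    obtain ⟨δ, hδ, hG⟩ := h ε hε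
    obtain ⟨n, hn⟩ := exists_nat_gt (T / δ)
    have hn0 : (0 : ℝ) < n := (div_nonneg hT hδ.le).trans_lt hn
    have hstep : T / n < δ := by
      rw [div_lt_iff₀ hn0]
      rwa [div_lt_iff₀ hδ, mul_comm] at hn
    have hind : ∀ k : ℕ, k ≤ n → |G (k * (T / n)) - G 0| ≤ ε * (K (k * (T / n)) - K 0) := by
      intro k
      induction k with
      | zero => simp
      | succ k ih =>
        intro hk
        have h1 := ih (by omega)
        have hTn : 0 ≤ T / n := by positivity
        have hk' : ((k + 1 : ℕ) : ℝ) ≤ n := by exact_mod_cast hk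
        have h2 := hG (k * (T / n)) ((k + 1 : ℕ) * (T / n)) (by positivity)
          (by push_cast; linarith) (by
            calc ((k + 1 : ℕ) : ℝ) * (T / n) ≤ n * (T / n) := by gcongr
              _ = T := by field_simp) (by push_cast; linarith)
        have h3 := abs_add_le (G ((k + 1 : ℕ) * (T / n)) - G (k * (T / n))) (G (k * (T / n)) - G 0)
        rw [sub_add_sub_cancel] at h3
        linarith
    have := hind n le_rfl
    rwa [mul_div_cancel₀ _ hn0.ne'] at this
  have hlim : Tendsto (fun ε : ℝ => ε * (K T - K 0)) (𝓝[>] 0) (𝓝 0) := by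
    have : Tendsto (fun ε : ℝ => ε * (K T - K 0)) (𝓝 0) (𝓝 (0 * (K T - K 0))) :=
      (continuous_id.mul continuous_const).tendsto 0
    rw [zero_mul] at this
    exact this.mono_left nhdsWithin_le_nhds
  have h0 : |G T - G 0| ≤ 0 := ge_of_tendsto hlim (by
    filter_upwards [self_mem_nhdsWithin] with ε hε using key ε hε)
  linarith [abs_eq_zero.1 (le_antisymm h0 (abs_nonneg _))]

lemma uniformContinuousOn_exists_delta {E : Type*} [NormedAddCommGroup E] {w : ℝ → E}
    (hw : ContinuousOn w (Icc 0 T)) {ε : ℝ} (hε : 0 < ε) :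
    ∃ δ > 0, ∀ s ∈ Icc 0 T, ∀ t ∈ Icc 0 T, |s - t| < δ → ‖w s - w t‖ < ε := by
  obtain ⟨δ, hδ, h⟩ := Metric.uniformContinuousOn_iff.1
    (isCompact_Icc.uniformContinuousOn_of_continuous hw) ε hε
  exact ⟨δ, hδ, fun s hs t ht hst => by simpa [dist_eq_norm] using h s hs t ht hst⟩

/-- The chain rule for the square of the norm of a primitive with respect to a measure. Since the
primitive is continuous there is no jump term. -/
lemma norm_sq_sub_norm_sq_eq_integral {H : Type*} [NormedAddCommGroup H] [InnerProductSpace ℝ H]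
    [CompleteSpace H] (hT : 0 ≤ T) {w h : ℝ → H} (hw : ContinuousOn w (Icc 0 T))
    (hh : IntervalIntegrable h ν 0 T)
    (hwh : ∀ a b, 0 ≤ a → a ≤ b → b ≤ T → w b - w a = ∫ t in a..b, h t ∂ν) :
    ‖w T‖ ^ 2 - ‖w 0‖ ^ 2 = 2 * ∫ t in 0..T, inner ℝ (w t) (h t) ∂ν := by
  have hwi : IntervalIntegrable (fun t => inner ℝ (w t) (h t)) ν 0 T := by
    obtain ⟨C, hC⟩ := isCompact_Icc.exists_bound_of_continuousOn hw
    rw [intervalIntegrable_iff_integrableOn_Ioc_of_le hT] at hh ⊢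
    refine (hh.norm.const_mul C).mono' ?_ ?_
    · exact ((hw.mono Ioc_subset_Icc_self).aestronglyMeasurable measurableSet_Ioc).inner hh.1
    · refine (ae_restrict_iff' measurableSet_Ioc).2 (ae_of_all _ fun t ht => ?_)
      refine (norm_inner_le_norm _ _).trans ?_
      gcongr
      exact hC t (Ioc_subset_Icc_self ht)
  have key := eq_of_locally_abs_sub_le (T := T)
    (G := fun t => ‖w t‖ ^ 2 - 2 * ∫ s in 0..t, inner ℝ (w s) (h s) ∂ν)
    (K := fun t => ∫ s in 0..t, ‖h s‖ ∂ν) hT ?_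
  · simp only [intervalIntegral.integral_same] at key
    linarith
  intro ε hε
  obtain ⟨δ, hδ, hu⟩ := uniformContinuousOn_exists_delta hw (half_pos hε)
  refine ⟨δ, hδ, fun a b ha hab hb hba => ?_⟩
  have hwi' := hwi.mono_Icc ha hab hb
  have hh' := hh.mono_Icc ha hab hb
  have e1 : (∫ s in 0..b, inner ℝ (w s) (h s) ∂ν) - ∫ s in 0..a, inner ℝ (w s) (h s) ∂ν =
      ∫ s in a..b, inner ℝ (w s) (h s) ∂ν :=
    intervalIntegral.integral_interval_sub_left (hwi.mono_Icc le_rfl (ha.trans hab) hb)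
      (hwi.mono_Icc le_rfl ha (hab.trans hb))
  have e2 : (∫ s in 0..b, ‖h s‖ ∂ν) - ∫ s in 0..a, ‖h s‖ ∂ν = ∫ s in a..b, ‖h s‖ ∂ν :=
    intervalIntegral.integral_interval_sub_left (hh.norm.mono_Icc le_rfl (ha.trans hab) hb)
      (hh.norm.mono_Icc le_rfl ha (hab.trans hb))
  have e3 : ‖w b‖ ^ 2 - ‖w a‖ ^ 2 = ∫ s in a..b, inner ℝ (w b + w a) (h s) ∂ν := by
    have : ‖w b‖ ^ 2 - ‖w a‖ ^ 2 = inner ℝ (w b + w a) (w b - w a) := by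
      rw [inner_add_left, inner_sub_right, inner_sub_right, real_inner_self_eq_norm_sq,
        real_inner_self_eq_norm_sq, real_inner_comm (w a) (w b)]
      ring
    rw [this, hwh a b ha hab hb]
    exact ((innerSL ℝ (w b + w a)).intervalIntegral_comp_comm hh').symm
  have hii : IntervalIntegrable (fun s => inner ℝ (w b + w a) (h s)) ν a b :=
    ⟨hh'.1.const_inner _, hh'.2.const_inner _⟩
  have e4 : ‖w b‖ ^ 2 - 2 * (∫ s in 0..b, inner ℝ (w s) (h s) ∂ν) -
      (‖w a‖ ^ 2 - 2 * ∫ s in 0..a, inner ℝ (w s) (h s) ∂ν) =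
      ∫ s in a..b, inner ℝ ((w b - w s) + (w a - w s)) (h s) ∂ν := by
    rw [show ∀ p q r s : ℝ, p - 2 * q - (r - 2 * s) = (p - r) - 2 * (q - s) by intros; ring,
      e1, e3, ← intervalIntegral.integral_const_mul,
      ← intervalIntegral.integral_sub hii (hwi'.const_mul 2)]
    congr 1 with s
    simp only [inner_add_left, inner_sub_left]
    ring
  rw [e4, e2, ← intervalIntegral.integral_const_mul, ← Real.norm_eq_abs]
  refine intervalIntegral.norm_integral_le_of_norm_le hab ?_ (hh'.norm.const_mul ε)
  refine ae_of_all _ fun s hs => (norm_inner_le_norm _ _).trans ?_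
  gcongr
  have hsT : s ∈ Icc 0 T := ⟨ha.trans hs.1.le, hs.2.trans hb⟩
  have h1 := hu b ⟨ha.trans hab, hb⟩ s hsT (by rw [abs_of_nonneg] <;> linarith [hs.1, hs.2])
  have h2 := hu a ⟨ha, hab.trans hb⟩ s hsT (by
    rw [abs_sub_comm, abs_of_nonneg] <;> linarith [hs.1, hs.2])
  exact (norm_add_le _ _).trans (by linarith)

lemma continuousOn_primitive_of_intervalIntegrable [NullSingletonClass ν] (hT : 0 ≤ T) {a : ℝ → ℝ}
    (ha : IntervalIntegrable a ν 0 T) :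
    ContinuousOn (fun t => ∫ s in 0..t, a s ∂ν) (Icc 0 T) := by
  have := intervalIntegral.continuousOn_primitive_interval (μ := ν) (a := 0) (b := T) (f := a) (by
    rw [uIcc_of_le hT, integrableOn_Icc_iff_integrableOn_Ioc]
    exact (intervalIntegrable_iff_integrableOn_Ioc_of_le hT).1 ha)
  rwa [uIcc_of_le hT] at this

/-- The inequality `∫ a e^{2N} dν ≤ e^{2N(T)} / 2`, where `N` is the primitive of `a`. -/
lemma integral_mul_exp_primitive_le [NullSingletonClass ν] (hT : 0 ≤ T) {a : ℝ → ℝ}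
    (ha0 : ∀ t, 0 ≤ a t) (ha : IntervalIntegrable a ν 0 T) :
    IntervalIntegrable (fun t => a t * Real.exp (2 * ∫ s in 0..t, a s ∂ν)) ν 0 T ∧
    ∫ t in 0..T, a t * Real.exp (2 * ∫ s in 0..t, a s ∂ν) ∂ν ≤
      Real.exp (2 * ∫ s in 0..T, a s ∂ν) / 2 := by
  set N : ℝ → ℝ := fun t => ∫ s in 0..t, a s ∂ν with hN
  have hNc : ContinuousOn N (Icc 0 T) := continuousOn_primitive_of_intervalIntegrable hT ha
  have hE : ContinuousOn (fun t => Real.exp (2 * N t)) (Icc 0 T) :=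
    Real.continuous_exp.comp_continuousOn (continuousOn_const.mul hNc)
  have hEi : IntervalIntegrable (fun t => a t * Real.exp (2 * N t)) ν 0 T := by
    have : uIcc 0 T = Icc 0 T := uIcc_of_le hT
    exact ha.mul_continuousOn (this ▸ hE)
  have hNsub : ∀ x y, 0 ≤ x → x ≤ y → y ≤ T → N y - N x = ∫ s in x..y, a s ∂ν :=
    fun x y hx hxy hy => intervalIntegral.integral_interval_sub_left
      (ha.mono_Icc le_rfl (hx.trans hxy) hy) (ha.mono_Icc le_rfl hx (hxy.trans hy))
  have hNmono : ∀ x y, 0 ≤ x → x ≤ y → y ≤ T → N x ≤ N y := fun x y hx hxy hy => by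
    have := hNsub x y hx hxy hy
    have := intervalIntegral.integral_nonneg (μ := ν) hxy fun u _ => ha0 u
    linarith
  refine ⟨hEi, ?_⟩
  have key := eq_of_locally_abs_sub_le (T := T)
    (G := fun t => Real.exp (2 * N t) - 2 * ∫ s in 0..t, a s * Real.exp (2 * N s) ∂ν)
    (K := N) hT ?_
  · have hN0 : N 0 = 0 := intervalIntegral.integral_same
    simp only [intervalIntegral.integral_same, hN0, mul_zero, Real.exp_zero] at key
    linarith
  intro ε hε
  obtain ⟨δ, hδ, hu⟩ := uniformContinuousOn_exists_delta hE (half_pos hε)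
  refine ⟨δ, hδ, fun x y hx hxy hy hyx => ?_⟩
  have e1 : (∫ s in 0..y, a s * Real.exp (2 * N s) ∂ν) - ∫ s in 0..x, a s * Real.exp (2 * N s) ∂ν =
      ∫ s in x..y, a s * Real.exp (2 * N s) ∂ν :=
    intervalIntegral.integral_interval_sub_left (hEi.mono_Icc le_rfl (hx.trans hxy) hy)
      (hEi.mono_Icc le_rfl hx (hxy.trans hy))
  have ha' := ha.mono_Icc hx hxy hy
  have hE' := hEi.mono_Icc hx hxy hy
  -- both terms lie between `e^{2N(x)} (N(y) - N(x))` and `e^{2N(y)} (N(y) - N(x))`, up to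
  -- the factor `2`
  have l1 : Real.exp (2 * N x) * (N y - N x) ≤ ∫ s in x..y, a s * Real.exp (2 * N s) ∂ν := by
    rw [hNsub x y hx hxy hy, ← intervalIntegral.integral_const_mul]
    refine intervalIntegral.integral_mono_on hxy (ha'.const_mul _) hE' fun s hs => ?_
    rw [mul_comm]
    have := ha0 s
    have := hNmono x s hx hs.1 (hs.2.trans hy)
    gcongr
  have l2 : ∫ s in x..y, a s * Real.exp (2 * N s) ∂ν ≤ Real.exp (2 * N y) * (N y - N x) := by
    rw [hNsub x y hx hxy hy, ← intervalIntegral.integral_const_mul]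
    refine intervalIntegral.integral_mono_on hxy hE' (ha'.const_mul _) fun s hs => ?_
    rw [mul_comm (Real.exp (2 * N y))]
    have := ha0 s
    have := hNmono s y (hx.trans hs.1) hs.2 hy
    gcongr
  have l3 : Real.exp (2 * N x) * (2 * (N y - N x)) ≤ Real.exp (2 * N y) - Real.exp (2 * N x) := by
    have h1 := Real.add_one_le_exp (2 * (N y - N x))
    have h2 : Real.exp (2 * N y) = Real.exp (2 * N x) * Real.exp (2 * (N y - N x)) := by
      rw [← Real.exp_add]; ring_nf
    rw [h2]
    nlinarith [Real.exp_pos (2 * N x)]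
  have l4 : Real.exp (2 * N y) - Real.exp (2 * N x) ≤ Real.exp (2 * N y) * (2 * (N y - N x)) := by
    have h1 := Real.add_one_le_exp (-(2 * (N y - N x)))
    have h2 : Real.exp (2 * N x) = Real.exp (2 * N y) * Real.exp (-(2 * (N y - N x))) := by
      rw [← Real.exp_add]; ring_nf
    rw [h2]
    nlinarith [Real.exp_pos (2 * N y)]
  have l5 : Real.exp (2 * N y) - Real.exp (2 * N x) ≤ ε / 2 := by
    have := hu y ⟨hx.trans hxy, hy⟩ x ⟨hx, hxy.trans hy⟩ (by rw [abs_of_nonneg] <;> linarith)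
    rw [Real.norm_eq_abs] at this
    exact (le_abs_self _).trans this.le
  have l6 := hNmono x y hx hxy hy
  have l7 : (Real.exp (2 * N y) - Real.exp (2 * N x)) * (N y - N x) ≤ ε / 2 * (N y - N x) := by
    gcongr
  rw [show ∀ p q r s : ℝ, p - 2 * q - (r - 2 * s) = (p - r) - 2 * (q - s) by intros; ring, e1,
    abs_le]
  constructor <;> nlinarith

/-- Grönwall's inequality in integral form, with respect to a measure without atoms. The constant
is not the optimal one. -/
lemma gronwall_of_integral_le [NullSingletonClass ν] (hT : 0 ≤ T) {a F : ℝ → ℝ} {C : ℝ}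
    (ha0 : ∀ t, 0 ≤ a t) (ha : IntervalIntegrable a ν 0 T) (hF : ContinuousOn F (Icc 0 T))
    (hC : ∀ t ∈ Icc 0 T, F t ≤ C + ∫ s in 0..t, a s * F s ∂ν) {t : ℝ} (ht : t ∈ Icc 0 T) :
    F t ≤ 2 * |C| * Real.exp (2 * ∫ s in 0..T, a s ∂ν) := by
  set N : ℝ → ℝ := fun t => ∫ s in 0..t, a s ∂ν with hN
  have hNc : ContinuousOn N (Icc 0 T) := continuousOn_primitive_of_intervalIntegrable hT ha
  have hNmono : ∀ x y, 0 ≤ x → x ≤ y → y ≤ T → N x ≤ N y := fun x y hx hxy hy => by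
    have : N y - N x = ∫ s in x..y, a s ∂ν := intervalIntegral.integral_interval_sub_left
      (ha.mono_Icc le_rfl (hx.trans hxy) hy) (ha.mono_Icc le_rfl hx (hxy.trans hy))
    have := intervalIntegral.integral_nonneg (μ := ν) hxy fun u _ => ha0 u
    linarith
  -- the maximum of `F e^{-2N}` is at most `2|C|`
  obtain ⟨τ, hτ, hmax⟩ := isCompact_Icc.exists_isMaxOn ⟨t, ht⟩
    (hF.mul (Real.continuous_exp.comp_continuousOn (continuousOn_const.mul hNc)) :
      ContinuousOn (fun t => F t * Real.exp (-2 * N t)) (Icc 0 T))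
  set M := F τ * Real.exp (-2 * N τ) with hM
  have hFM : ∀ s ∈ Icc 0 T, F s ≤ M * Real.exp (2 * N s) := fun s hs => by
    have h1 : F s * Real.exp (-2 * N s) ≤ M := hmax hs
    calc F s = F s * Real.exp (-2 * N s) * Real.exp (2 * N s) := by
          rw [mul_assoc, ← Real.exp_add]; ring_nf; simp
      _ ≤ M * Real.exp (2 * N s) := by gcongr
  have hM2 : M ≤ 2 * |C| := by
    rcases le_or_gt M 0 with h0 | h0
    · exact h0.trans (by positivity)
    obtain ⟨hi, hle⟩ := integral_mul_exp_primitive_le hτ.1 ha0 (ha.mono_Icc le_rfl hτ.1 hτ.2)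
    have haF : IntervalIntegrable (fun s => a s * F s) ν 0 τ := by
      refine (ha.mono_Icc le_rfl hτ.1 hτ.2).mul_continuousOn ?_
      rw [uIcc_of_le hτ.1]
      exact hF.mono (Icc_subset_Icc le_rfl hτ.2)
    have h1 : ∫ s in 0..τ, a s * F s ∂ν ≤ M * (Real.exp (2 * N τ) / 2) := by
      refine le_trans ?_ (mul_le_mul_of_nonneg_left hle h0.le)
      rw [← intervalIntegral.integral_const_mul]
      refine intervalIntegral.integral_mono_on hτ.1 haF (hi.const_mul M) fun s hs => ?_
      have := mul_le_mul_of_nonneg_left (hFM s ⟨hs.1, hs.2.trans hτ.2⟩) (ha0 s)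
      calc a s * F s ≤ _ := this
        _ = _ := by ring
    have h2 := hC τ hτ
    have h3 : F τ = M * Real.exp (2 * N τ) := by
      rw [hM, mul_assoc, ← Real.exp_add]; ring_nf; simp
    have h4 : 1 ≤ Real.exp (2 * N τ) := by
      have : N 0 = 0 := intervalIntegral.integral_same
      have := hNmono 0 τ le_rfl hτ.1 hτ.2
      exact Real.one_le_exp (by linarith)
    have h5 : C ≤ |C| := le_abs_self C
    have h6 : 0 ≤ |C| := abs_nonneg C
    have h7 : M * Real.exp (2 * N τ) ≤ 2 * |C| := by linarith
    nlinarith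
  calc F t ≤ M * Real.exp (2 * N t) := hFM t ht
    _ ≤ 2 * |C| * Real.exp (2 * N T) := by
      have := hNmono t T ht.1 ht.2 le_rfl
      gcongr

end Gronwall

/-! ### Prox-regular sets -/

section ProxRegular

variable {H : Type*} [NormedAddCommGroup H] [InnerProductSpace ℝ H] {r : ℝ} {Z : Set H}

lemma norm_sub_le_of_mem_proj {v x z : H} (hx : x ∈ proj Z v) (hz : z ∈ Z) :
    ‖x - v‖ ≤ ‖z - v‖ := by
  rw [hx.2, ← dist_eq_norm, dist_comm]
  exact Metric.infDist_le_dist_of_mem hz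

/-- Expanding the square in `‖x - (x + c n)‖ ≤ ‖z - (x + c n)‖`. -/
lemma inner_le_of_norm_sub_le {x z n : H} {c : ℝ} (hc : 0 < c)
    (h : ‖x - (x + c • n)‖ ≤ ‖z - (x + c • n)‖) :
    inner ℝ n (z - x) ≤ 1 / (2 * c) * ‖z - x‖ ^ 2 := by
  have h1 : ‖x - (x + c • n)‖ ^ 2 ≤ ‖z - (x + c • n)‖ ^ 2 := by gcongr
  rw [show x - (x + c • n) = -(c • n) by abel, show z - (x + c • n) = (z - x) - c • n by abel,
    norm_neg, norm_sub_sq_real, inner_smul_right, real_inner_comm] at h1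
  rw [div_mul_eq_mul_div, one_mul, le_div_iff₀ (by positivity)]
  linarith

lemma norm_sub_le_of_inner_le {x z n : H} {c : ℝ} (hc : 0 < c)
    (h : inner ℝ n (z - x) ≤ 1 / (2 * c) * ‖z - x‖ ^ 2) :
    ‖x - (x + c • n)‖ ≤ ‖z - (x + c • n)‖ := by
  refine le_of_sq_le_sq ?_ (norm_nonneg _)
  rw [show x - (x + c • n) = -(c • n) by abel, show z - (x + c • n) = (z - x) - c • n by abel,
    norm_neg, norm_sub_sq_real, inner_smul_right, real_inner_comm]
  rw [div_mul_eq_mul_div, one_mul, le_div_iff₀ (by positivity)] at h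
  linarith

/-- The normal inequality at a projection: `v - x` is a proximal normal with the uniform
constant `‖v - x‖ / (2r)`. -/
lemma IsProxRegular.inner_le_of_mem_proj (hZ : IsProxRegular r Z) (hr : 0 < r) {v x z : H}
    (hv : Metric.infDist v Z < r) (hx : x ∈ proj Z v) (hz : z ∈ Z) :
    inner ℝ (v - x) (z - x) ≤ ‖v - x‖ / (2 * r) * ‖z - x‖ ^ 2 := by
  rcases eq_or_ne v x with rfl | hne
  · simp
  have hpos : 0 < ‖v - x‖ := norm_pos_iff.2 (sub_ne_zero.2 hne)
  have hd : Metric.infDist v Z = ‖v - x‖ := by rw [← hx.2, norm_sub_rev]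
  have h := hZ.mem_proj v (hd ▸ hpos) hv x hx
  have h2 := inner_le_of_norm_sub_le (div_pos hr hpos) (norm_sub_le_of_mem_proj h hz)
  refine h2.trans (le_of_eq ?_)
  field_simp

/-- In an `r`-prox-regular set every proximal normal satisfies the normal inequality with the
uniform constant `‖n‖ / (2r)`, whatever constant it is known to satisfy it with. -/
lemma IsProxRegular.inner_le_of_forall_inner_le (hZ : IsProxRegular r Z) (hr : 0 < r) {x n : H}
    (hx : x ∈ Z) {M : ℝ} (h : ∀ z ∈ Z, inner ℝ n (z - x) ≤ M * ‖z - x‖ ^ 2) {z : H} (hz : z ∈ Z) :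
    inner ℝ n (z - x) ≤ ‖n‖ / (2 * r) * ‖z - x‖ ^ 2 := by
  rcases eq_or_ne n 0 with rfl | hn
  · simp
  have hn' : 0 < ‖n‖ := norm_pos_iff.2 hn
  -- a step `c` so short that `x` is the projection of `x + c n` and `x + c n` is within `r` of `Z`
  obtain ⟨c, hc, hc1, hc2⟩ : ∃ c : ℝ, 0 < c ∧ M ≤ 1 / (2 * c) ∧ c * ‖n‖ < r := by
    refine ⟨min (1 / (2 * (|M| + 1))) (r / (2 * ‖n‖)), by positivity, ?_, ?_⟩
    · have h1 : min (1 / (2 * (|M| + 1))) (r / (2 * ‖n‖)) ≤ 1 / (2 * (|M| + 1)) := min_le_left _ _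
      rw [le_div_iff₀ (by positivity)]
      have h3 : M ≤ |M| + 1 := by linarith [le_abs_self M]
      have h2 : (0 : ℝ) < min (1 / (2 * (|M| + 1))) (r / (2 * ‖n‖)) := by positivity
      calc M * (2 * min (1 / (2 * (|M| + 1))) (r / (2 * ‖n‖)))
          ≤ (|M| + 1) * (2 * (1 / (2 * (|M| + 1)))) := by gcongr
        _ = 1 := by field_simp
    · calc min (1 / (2 * (|M| + 1))) (r / (2 * ‖n‖)) * ‖n‖ ≤ r / (2 * ‖n‖) * ‖n‖ := by
            gcongr; exact min_le_right _ _
        _ = r / 2 := by field_simp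
        _ < r := by linarith
  have hproj : x ∈ proj Z (x + c • n) := by
    refine ⟨hx, le_antisymm ?_ ?_⟩
    · refine (Metric.le_infDist ⟨x, hx⟩).2 fun z hz => ?_
      rw [dist_comm, dist_eq_norm]
      exact norm_sub_le_of_inner_le hc ((h z hz).trans (by gcongr))
    · rw [← dist_eq_norm, dist_comm]
      exact Metric.infDist_le_dist_of_mem hx
  have hnorm : ‖x + c • n - x‖ = c * ‖n‖ := by
    rw [add_sub_cancel_left, norm_smul, Real.norm_of_nonneg hc.le]
  have hv : Metric.infDist (x + c • n) Z < r := by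
    rw [← hproj.2, norm_sub_rev, hnorm]
    exact hc2
  have := hZ.inner_le_of_mem_proj hr hv hproj hz
  rw [hnorm, add_sub_cancel_left, inner_smul_left] at this
  simp only [conj_trivial] at this
  have h2 : c * inner ℝ n (z - x) ≤ c * (‖n‖ / (2 * r) * ‖z - x‖ ^ 2) := by
    refine this.trans (le_of_eq ?_)
    ring
  exact le_of_mul_le_mul_left h2 hc

lemma IsProxRegular.exists_mem_proj (hZ : IsProxRegular r Z) (hne : Z.Nonempty) {v : H}
    (hv : Metric.infDist v Z < r) : ∃ x, x ∈ proj Z v := by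
  rcases (Metric.infDist_nonneg (x := v) (s := Z)).eq_or_lt with h0 | h0
  · exact ⟨v, (hZ.isClosed.mem_iff_infDist_zero hne).2 h0.symm, by simp [← h0]⟩
  · exact hZ.nonempty_proj v h0 hv

end ProxRegular

/-! ### Functions of bounded variation -/

section BoundedVariation

variable {E : Type*} [NormedAddCommGroup E]

lemma _root_.BoundedVariationOn.add {f g : ℝ → E} {s : Set ℝ} (hf : BoundedVariationOn f s)
    (hg : BoundedVariationOn g s) : BoundedVariationOn (fun t => f t + g t) s := by
  refine ne_top_of_le_ne_top (ENNReal.add_ne_top.2 ⟨hf, hg⟩) (iSup_le fun ⟨n, v, hv, hvs⟩ => ?_)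
  refine le_trans ?_ (add_le_add (eVariationOn.sum_le (n := n) hv hvs)
    (eVariationOn.sum_le (n := n) hv hvs))
  rw [← Finset.sum_add_distrib]
  exact Finset.sum_le_sum fun i _ => edist_add_add_le _ _ _ _

lemma _root_.BoundedVariationOn.neg {f : ℝ → E} {s : Set ℝ} (hf : BoundedVariationOn f s) :
    BoundedVariationOn (fun t => -f t) s := by
  have : LipschitzWith 1 fun x : E => -x :=
    LipschitzWith.of_edist_le fun x y => by rw [edist_neg_neg]
  exact this.comp_boundedVariationOn hf

lemma _root_.BoundedVariationOn.sub {f g : ℝ → E} {s : Set ℝ} (hf : BoundedVariationOn f s)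
    (hg : BoundedVariationOn g s) : BoundedVariationOn (fun t => f t - g t) s := by
  simpa only [sub_eq_add_neg] using hf.add hg.neg

/-- Gluing two functions of bounded variation, with a jump allowed at the gluing point. -/
lemma boundedVariationOn_ite [NormedSpace ℝ E] {f g : ℝ → E} {T : ℝ}
    (hf : BoundedVariationOn f (Icc 0 T)) (hg : BoundedVariationOn g (Icc 0 T)) (t : ℝ) :
    BoundedVariationOn (fun s => if s ≤ t then f s else g s) (Icc 0 T) := by
  have hmono : Monotone fun s : ℝ => if s ≤ t then (0 : ℝ) else 1 := by
    intro a b hab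
    dsimp only
    split_ifs <;> linarith
  have h1 : BoundedVariationOn (fun s : ℝ => if s ≤ t then (0 : ℝ) else 1) (Icc 0 T) := by
    refine (hmono.monotoneOn (Icc 0 T)).boundedVariationOn (C := 1) fun s _ => ?_
    split_ifs <;> simp
  convert hf.add (h1.smul (hg.sub hf)) using 2 with s
  by_cases h : s ≤ t <;> simp [h]

end BoundedVariation

/-! ### Uniqueness for the play problem -/

section Uniqueness

variable {H : Type*} [NormedAddCommGroup H] [InnerProductSpace ℝ H] [CompleteSpace H]
  {r T : ℝ} {Z : Set H} {u y₁ y₂ : ℝ → H} {z₁ z₂ : H}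

/-- The variational inequality for `y₁`, localised to `[0, t]` by testing with `u - y₂` on `[0, t]`
and with `u - y₁` afterwards. -/
lemma IsPlaySolution.integral_inner_le {hT : 0 ≤ T} (hr : 0 < r)
    (h₁ : IsPlaySolution hT r Z u z₁ y₁) (h₂ : IsPlaySolution hT r Z u z₂ y₂)
    (hu : BoundedVariationOn u (Icc 0 T)) {ν : Measure ℝ} [IsFiniteMeasure ν]
    [NullSingletonClass ν] {g : ℝ → H} (hg : StronglyMeasurable g) (hgi : Integrable g ν)
    (hm : differentialMeasure hT h₁.boundedVariationOn = ν.withDensityᵥ g)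
    (hle : (differentialMeasure hT h₁.boundedVariationOn).variation ≤ ν) {t : ℝ}
    (ht : t ∈ Icc 0 T) :
    ∫ s in 0..t, inner ℝ (y₁ s - y₂ s) (g s) ∂ν ≤
      1 / (2 * r) * ∫ s in 0..t, ‖y₁ s - y₂ s‖ ^ 2 ∂ν := by
  have hsub : Icc 0 t ⊆ Icc 0 T := Icc_subset_Icc le_rfl ht.2
  have hwc : ContinuousOn (fun s => y₁ s - y₂ s) (Icc 0 t) :=
    (h₁.continuousOn.sub h₂.continuousOn).mono hsub
  set φ : ℝ → H := (Icc 0 t).indicator fun s => y₁ s - y₂ s with hφ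
  have hvar := h₁.variational (fun s => if s ≤ t then u s - y₂ s else u s - y₁ s)
    (boundedVariationOn_ite (hu.sub h₂.boundedVariationOn) (hu.sub h₁.boundedVariationOn) t)
    (fun s hs => by
      split_ifs
      exacts [h₂.sub_mem s hs, h₁.sub_mem s hs])
  have heq : EqOn (fun s => (if s ≤ t then u s - y₂ s else u s - y₁ s) - u s + y₁ s) φ
      (Icc 0 T) := fun s hs => by
    by_cases hst : s ≤ t
    · simp only [hst, if_true, hφ, indicator_of_mem (show s ∈ Icc 0 t from ⟨hs.1, hst⟩)]
      abel
    · simp [hst, hφ]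
  have hfin := isFiniteMeasure_variation_differentialMeasure hT h₁.boundedVariationOn
  have hφi : ∀ μ : Measure ℝ, IsFiniteMeasure μ → Integrable φ μ := fun μ _ => by
    rw [hφ, integrable_indicator_iff measurableSet_Icc]
    exact hwc.integrableOn_Icc
  have hsupp : (Icc 0 T).indicator φ = φ := by
    rw [hφ, indicator_indicator, inter_eq_self_of_subset_right hsub]
  have hφi' := hφi _ hfin
  rw [hm, Measure.variation_withDensityᵥ hgi] at hφi'
  rw [VectorMeasure.setIntegral_congr_fun heq, ← VectorMeasure.integral_indicator measurableSet_Icc,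
    hsupp, setIntegral_congr_fun measurableSet_Icc
      (fun s hs => congrArg (fun v => ‖v‖ ^ 2) (heq hs) :
        EqOn _ (fun s => ‖φ s‖ ^ 2) (Icc 0 T))] at hvar
  have hsq : ∀ s, ‖φ s‖ ^ 2 = (Icc 0 t).indicator (fun s => ‖y₁ s - y₂ s‖ ^ 2) s := fun s => by
    by_cases hs : s ∈ Icc 0 t <;> simp [hφ, hs]
  have hin : ∀ s, inner ℝ (φ s) (g s) =
      (Icc 0 t).indicator (fun s => inner ℝ (y₁ s - y₂ s) (g s)) s := fun s => by
    by_cases hs : s ∈ Icc 0 t <;> simp [hφ, hs]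
  have hL : ∫ᵛ s, φ s ∂[innerSL ℝ; differentialMeasure hT h₁.boundedVariationOn] =
      ∫ s in 0..t, inner ℝ (y₁ s - y₂ s) (g s) ∂ν := by
    rw [hm, integral_innerSL_withDensityᵥ hg hgi hφi']
    simp only [hin]
    rw [integral_indicator measurableSet_Icc, intervalIntegral.integral_of_le ht.1,
      integral_Icc_eq_integral_Ioc]
  rw [hL] at hvar
  refine hvar.trans (mul_le_mul_of_nonneg_left ?_ (by positivity))
  rw [intervalIntegral.integral_of_le ht.1, ← integral_Icc_eq_integral_Ioc]
  simp only [hsq]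
  rw [setIntegral_indicator measurableSet_Icc, inter_eq_self_of_subset_right hsub]
  refine integral_mono_measure (Measure.restrict_mono le_rfl hle)
    (ae_of_all _ fun s => by positivity) ?_
  exact (hwc.norm.pow 2).integrableOn_Icc

lemma IsPlaySolution.eqOn {hT : 0 ≤ T} (hr : 0 < r) (hu : BoundedVariationOn u (Icc 0 T))
    {z₀ : H} (h₁ : IsPlaySolution hT r Z u z₀ y₁) (h₂ : IsPlaySolution hT r Z u z₀ y₂) :
    EqOn y₁ y₂ (Icc 0 T) := by
  set m₁ := differentialMeasure hT h₁.boundedVariationOn with hm₁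
  set m₂ := differentialMeasure hT h₂.boundedVariationOn with hm₂
  have hf₁ : IsFiniteMeasure m₁.variation := isFiniteMeasure_variation_differentialMeasure hT _
  have hf₂ : IsFiniteMeasure m₂.variation := isFiniteMeasure_variation_differentialMeasure hT _
  have hn₁ : NullSingletonClass m₁.variation :=
    nullSingletonClass_variation_differentialMeasure hT _ h₁.continuousOn
  have hn₂ : NullSingletonClass m₂.variation :=
    nullSingletonClass_variation_differentialMeasure hT _ h₂.continuousOn
  -- a common measure with respect to which both differential measures have densities
  set ν := m₁.variation + m₂.variation with hν
  have hnν : NullSingletonClass ν := ⟨fun x => by simp [hν]⟩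
  have hle₁ : m₁.variation ≤ ν := Measure.le_add_right le_rfl
  have hle₂ : m₂.variation ≤ ν := Measure.le_add_left le_rfl
  obtain ⟨g₁, hg₁, hg₁i, e₁⟩ := exists_eq_withDensityᵥ m₁ ν hle₁
  obtain ⟨g₂, hg₂, hg₂i, e₂⟩ := exists_eq_withDensityᵥ m₂ ν hle₂
  have hwc : ContinuousOn (fun s => y₁ s - y₂ s) (Icc 0 T) := h₁.continuousOn.sub h₂.continuousOn
  have hinc : ∀ a b, 0 ≤ a → a ≤ b → b ≤ T →
      (y₁ b - y₂ b) - (y₁ a - y₂ a) = ∫ t in a..b, (g₁ t - g₂ t) ∂ν := by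
    intro a b ha hab hb
    have i₁ := differentialMeasure_Ioc hT h₁.boundedVariationOn h₁.continuousOn hab
    have i₂ := differentialMeasure_Ioc hT h₂.boundedVariationOn h₂.continuousOn hab
    rw [← hm₁, e₁, withDensityᵥ_apply hg₁i measurableSet_Ioc,
      constExtend_of_mem hT _ ⟨ha.trans hab, hb⟩, constExtend_of_mem hT _ ⟨ha, hab.trans hb⟩] at i₁
    rw [← hm₂, e₂, withDensityᵥ_apply hg₂i measurableSet_Ioc,
      constExtend_of_mem hT _ ⟨ha.trans hab, hb⟩, constExtend_of_mem hT _ ⟨ha, hab.trans hb⟩] at i₂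
    rw [intervalIntegral.integral_of_le hab, integral_sub hg₁i.integrableOn hg₂i.integrableOn,
      i₁, i₂]
    abel
  have hw0 : y₁ 0 - y₂ 0 = 0 := by
    have := h₁.initial.trans h₂.initial.symm
    rw [sub_right_inj] at this
    rw [this, sub_self]
  have key : ∀ t ∈ Icc 0 T, ‖y₁ t - y₂ t‖ ^ 2 ≤
      0 + ∫ s in 0..t, 2 / r * ‖y₁ s - y₂ s‖ ^ 2 ∂ν := by
    intro t ht
    have hwt := hwc.mono (Icc_subset_Icc le_rfl ht.2)
    have hch := norm_sq_sub_norm_sq_eq_integral (ν := ν) ht.1 (w := fun s => y₁ s - y₂ s)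
      (h := fun s => g₁ s - g₂ s) hwt (hg₁i.sub hg₂i).intervalIntegrable
      fun a b ha hab hb => hinc a b ha hab (hb.trans ht.2)
    have q₁ := h₁.integral_inner_le hr h₂ hu hg₁ hg₁i e₁ hle₁ ht
    have q₂ := h₂.integral_inner_le hr h₁ hu hg₂ hg₂i e₂ hle₂ ht
    have hbd : ∀ g : ℝ → H, StronglyMeasurable g → Integrable g ν →
        IntervalIntegrable (fun s => inner ℝ (y₁ s - y₂ s) (g s)) ν 0 t := by
      intro g hg hgi
      obtain ⟨C, hC⟩ := isCompact_Icc.exists_bound_of_continuousOn hwt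
      rw [intervalIntegrable_iff_integrableOn_Ioc_of_le ht.1]
      refine (hgi.integrableOn.norm.const_mul C).mono' ?_ ?_
      · exact ((hwt.mono Ioc_subset_Icc_self).aestronglyMeasurable measurableSet_Ioc).inner
          hg.aestronglyMeasurable
      · refine (ae_restrict_iff' measurableSet_Ioc).2 (ae_of_all _ fun s hs => ?_)
        refine (norm_inner_le_norm _ _).trans ?_
        gcongr
        exact hC s (Ioc_subset_Icc_self hs)
    have q₃ : ∫ s in 0..t, inner ℝ (y₁ s - y₂ s) (g₁ s - g₂ s) ∂ν =
        (∫ s in 0..t, inner ℝ (y₁ s - y₂ s) (g₁ s) ∂ν) +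
          ∫ s in 0..t, inner ℝ (y₂ s - y₁ s) (g₂ s) ∂ν := by
      rw [show (fun s => inner ℝ (y₂ s - y₁ s) (g₂ s)) = fun s => -inner ℝ (y₁ s - y₂ s) (g₂ s) by
        ext s; rw [← inner_neg_left, neg_sub], intervalIntegral.integral_neg, ← sub_eq_add_neg,
        ← intervalIntegral.integral_sub (hbd g₁ hg₁ hg₁i) (hbd g₂ hg₂ hg₂i)]
      simp only [inner_sub_right]
    simp only [norm_sub_rev (y₂ _) (y₁ _)] at q₂
    simp only [hw0, norm_zero] at hch
    rw [intervalIntegral.integral_const_mul, zero_add]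
    rw [q₃] at hch
    have : 2 / r = 2 * (1 / (2 * r)) + 2 * (1 / (2 * r)) := by field_simp; norm_num
    rw [this]
    linarith
  intro t ht
  have := gronwall_of_integral_le (ν := ν) hT (a := fun _ => 2 / r)
    (F := fun t => ‖y₁ t - y₂ t‖ ^ 2) (C := 0) (fun _ => by positivity)
    intervalIntegrable_const (hwc.norm.pow 2) key ht
  simp only [abs_zero, mul_zero, zero_mul] at this
  have h0 : ‖y₁ t - y₂ t‖ = 0 := by
    have := sq_nonneg ‖y₁ t - y₂ t‖
    exact pow_eq_zero_iff (two_ne_zero) |>.1 (by linarith)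
  exact sub_eq_zero.1 (norm_eq_zero.1 h0)

end Uniqueness

/-! ### The catching-up algorithm -/

section Approximation

variable {H : Type*} [NormedAddCommGroup H] [InnerProductSpace ℝ H] {r ε : ℝ} {L : ℝ≥0} {Z : Set H}
  {u : ℝ → H} {z₀ : H}

/-- The primitive of `g` starting at `u 0 - z₀` solves the play problem up to an error `ε`: the
speed `g` is at every time a proximal normal to `Z`, with constant `L / (2r)`, at a point of `Z`
which is `ε`-close to `u - y`. -/
structure IsApproxSolution (r : ℝ) (L : ℝ≥0) (ε : ℝ) (Z : Set H) (u : ℝ → H) (z₀ : H)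
    (y g : ℝ → H) : Prop where
  stronglyMeasurable : StronglyMeasurable g
  norm_le : ∀ t, ‖g t‖ ≤ L
  eq_primitive : ∀ t, y t = u 0 - z₀ + ∫ s in 0..t, g s
  normal : ∀ t, 0 ≤ t → ∃ x ∈ Z, ‖x - (u t - y t)‖ ≤ ε ∧
    ∀ z ∈ Z, inner ℝ (g t) (z - x) ≤ L / (2 * r) * ‖z - x‖ ^ 2

variable {y g : ℝ → H}

lemma IsApproxSolution.intervalIntegrable (h : IsApproxSolution r L ε Z u z₀ y g) (a b : ℝ) :
    IntervalIntegrable g volume a b :=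
  (intervalIntegrable_const (c := (L : ℝ))).mono_fun h.stronglyMeasurable.aestronglyMeasurable
    (ae_of_all _ fun t => by simpa using h.norm_le t)

lemma IsApproxSolution.sub_eq_integral (h : IsApproxSolution r L ε Z u z₀ y g) (a b : ℝ) :
    y b - y a = ∫ t in a..b, g t := by
  rw [h.eq_primitive, h.eq_primitive, add_sub_add_left_eq_sub,
    intervalIntegral.integral_interval_sub_left (h.intervalIntegrable 0 b)
      (h.intervalIntegrable 0 a)]

lemma IsApproxSolution.lipschitzWith (h : IsApproxSolution r L ε Z u z₀ y g) :
    LipschitzWith L y := by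
  refine LipschitzWith.of_dist_le_mul fun b a => ?_
  rw [dist_eq_norm, h.sub_eq_integral a b, Real.dist_eq]
  exact intervalIntegral.norm_integral_le_of_norm_le_const fun t _ => h.norm_le t

/-- Moreau's catching-up algorithm: with `h` the time step, `x (k + 1)` is a projection of
`x k + u ((k + 1) h) - u (k h)`. -/
lemma IsProxRegular.exists_catchingUp (hZ : IsProxRegular r Z) (hu : LipschitzWith L u)
    (hz₀ : z₀ ∈ Z) {h : ℝ} (hh : 0 < h) (hhr : L * h < r) :
    ∃ x : ℕ → H, x 0 = z₀ ∧ ∀ k, x k ∈ Z ∧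
      x (k + 1) ∈ proj Z (x k + (u ((k + 1 : ℕ) * h) - u (k * h))) ∧
      ‖u ((k + 1 : ℕ) * h) - u (k * h)‖ ≤ L * h := by
  have hstep : ∀ k : ℕ, ‖u ((k + 1 : ℕ) * h) - u (k * h)‖ ≤ L * h := fun k => by
    have := hu.dist_le_mul ((k + 1 : ℕ) * h) (k * h)
    rw [dist_eq_norm, Real.dist_eq, ← sub_mul] at this
    simpa [abs_of_pos hh] using this
  have hex : ∀ (k : ℕ) (x : Z), ∃ x' : Z,
      (x' : H) ∈ proj Z ((x : H) + (u ((k + 1 : ℕ) * h) - u (k * h))) := fun k x => by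
    have hd : Metric.infDist ((x : H) + (u ((k + 1 : ℕ) * h) - u (k * h))) Z < r := by
      refine (Metric.infDist_le_dist_of_mem x.2).trans_lt ?_
      rw [dist_eq_norm, add_sub_cancel_left]
      exact (hstep k).trans_lt hhr
    obtain ⟨x', hx'⟩ := hZ.exists_mem_proj ⟨_, hz₀⟩ hd
    exact ⟨⟨x', hx'.1⟩, hx'⟩
  choose F hF using hex
  let X : ℕ → Z := fun k => Nat.rec (motive := fun _ => Z) ⟨z₀, hz₀⟩ F k
  refine ⟨fun k => (X k : H), rfl, fun k => ⟨(X k).2, ?_, hstep k⟩⟩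
  exact hF k (X k)

/-- The catching-up algorithm with a small time step gives approximate solutions. -/
lemma IsProxRegular.exists_isApproxSolution [CompleteSpace H] (hZ : IsProxRegular r Z) (hr : 0 < r)
    (hu : LipschitzWith L u) (hz₀ : z₀ ∈ Z) (hε : 0 < ε) :
    ∃ y g, IsApproxSolution r L ε Z u z₀ y g := by
  -- the time step
  obtain ⟨h, hh, hhr, hhε⟩ : ∃ h : ℝ, 0 < h ∧ L * h < r ∧ 2 * (L * h) ≤ ε := by
    have hL : (0 : ℝ) ≤ L := L.2
    refine ⟨min r (ε / 2) / (L + 1), by positivity, ?_, ?_⟩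
    · calc L * (min r (ε / 2) / (L + 1)) < (L + 1) * (min r (ε / 2) / (L + 1)) := by
            gcongr; linarith
        _ = min r (ε / 2) := by field_simp
        _ ≤ r := min_le_left _ _
    · have : L * (min r (ε / 2) / (L + 1)) ≤ ε / 2 := by
        calc L * (min r (ε / 2) / (L + 1)) ≤ (L + 1) * (min r (ε / 2) / (L + 1)) := by
              gcongr; linarith
          _ = min r (ε / 2) := by field_simp
          _ ≤ ε / 2 := min_le_right _ _
      linarith
  obtain ⟨x, hx0, hx⟩ := hZ.exists_catchingUp hu hz₀ hh hhr
  set t : ℕ → ℝ := fun k => k * h with ht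
  -- the increments of the approximate solution, which are proximal normals at `x (k + 1)`
  set d : ℕ → H := fun k => x k + (u (t (k + 1)) - u (t k)) - x (k + 1) with hd
  have hdn : ∀ k, ‖d k‖ ≤ L * h := fun k => by
    obtain ⟨hk, hp, hs⟩ := hx k
    rw [hd, norm_sub_rev]
    refine (norm_sub_le_of_mem_proj hp hk).trans ?_
    rw [sub_add_cancel_left, norm_neg]
    exact hs
  have hdz : ∀ k, ∀ z ∈ Z, inner ℝ (d k) (z - x (k + 1)) ≤
      L * h / (2 * r) * ‖z - x (k + 1)‖ ^ 2 := fun k z hz => by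
    obtain ⟨hk, hp, hs⟩ := hx k
    have hdist : Metric.infDist (x k + (u (t (k + 1)) - u (t k))) Z < r := by
      rw [← hp.2, norm_sub_rev]
      exact (hdn k).trans_lt hhr
    refine (hZ.inner_le_of_mem_proj hr hdist hp hz).trans ?_
    gcongr
    exact hdn k
  -- the velocity is constant on each time step
  set g : ℝ → H := fun s => h⁻¹ • d ⌊s / h⌋₊ with hg
  have hgm : StronglyMeasurable g := by
    have : StronglyMeasurable fun k : ℕ => h⁻¹ • d k := .of_discrete
    exact this.comp_measurable (Nat.measurable_floor.comp (measurable_id.div_const h))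
  have hgn : ∀ s, ‖g s‖ ≤ L := fun s => by
    rw [hg, norm_smul, norm_inv, Real.norm_of_nonneg hh.le, inv_mul_le_iff₀ hh, mul_comm]
    exact hdn _
  set y : ℝ → H := fun s => u 0 - z₀ + ∫ τ in 0..s, g τ with hy
  have hgi : ∀ a b, IntervalIntegrable g volume a b := fun a b =>
    (intervalIntegrable_const (c := (L : ℝ))).mono_fun hgm.aestronglyMeasurable
      (ae_of_all _ fun t => by simpa using hgn t)
  have hyL : LipschitzWith L y := by
    refine LipschitzWith.of_dist_le_mul fun b a => ?_
    rw [dist_eq_norm, hy, add_sub_add_left_eq_sub, Real.dist_eq,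
      intervalIntegral.integral_interval_sub_left (hgi 0 b) (hgi 0 a)]
    exact intervalIntegral.norm_integral_le_of_norm_le_const fun t _ => hgn t
  have hfloor : ∀ k : ℕ, ∀ s ∈ Ico (t k) (t (k + 1)), ⌊s / h⌋₊ = k := fun k s hs => by
    rw [Nat.floor_eq_iff (div_nonneg ((by positivity : 0 ≤ t k).trans hs.1) hh.le),
      le_div_iff₀ hh, div_lt_iff₀ hh]
    refine ⟨hs.1, ?_⟩
    have := hs.2
    simpa [ht] using this
  have htk : ∀ k : ℕ, t (k + 1) = t k + h := fun k => by simp [ht]; ring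
  have hnode : ∀ k, y (t k) = u (t k) - x k := by
    intro k
    induction k with
    | zero => simp [hy, ht, hx0]
    | succ k ih =>
      have h1 : ∫ s in t k..t (k + 1), g s = d k := by
        rw [intervalIntegral.integral_of_le (by rw [htk]; linarith),
          ← integral_Ico_eq_integral_Ioc,
          setIntegral_congr_fun (g := fun _ => h⁻¹ • d k) measurableSet_Ico
            fun s hs => by simp only [hg, hfloor k s hs],
          setIntegral_const, measureReal_def, Real.volume_Ico, htk, add_sub_cancel_left,
          ENNReal.toReal_ofReal hh.le, smul_smul, mul_inv_cancel₀ hh.ne', one_smul]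
      have h2 : y (t (k + 1)) - y (t k) = d k := by
        rw [hy, add_sub_add_left_eq_sub,
          intervalIntegral.integral_interval_sub_left (hgi _ _) (hgi _ _), h1]
      rw [← sub_add_cancel (y (t (k + 1))) (y (t k)), h2, ih, hd]
      dsimp only
      abel
  refine ⟨y, g, hgm, hgn, fun _ => rfl, fun s hs => ?_⟩
  set k := ⌊s / h⌋₊ with hk
  have hk1 : t k ≤ s := by
    have := Nat.floor_le (div_nonneg hs hh.le)
    rwa [le_div_iff₀ hh] at this
  have hk2 : s < t (k + 1) := by
    have := Nat.lt_floor_add_one (s / h)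
    rw [div_lt_iff₀ hh] at this
    simpa [ht] using this
  refine ⟨x (k + 1), (hx (k + 1)).1, ?_, fun z hz => ?_⟩
  · have e : x (k + 1) - (u s - y s) = (u (t (k + 1)) - u s) - (y (t (k + 1)) - y s) := by
      rw [hnode (k + 1)]
      abel
    have hle : |t (k + 1) - s| ≤ h := by
      rw [abs_of_pos (by linarith), htk]
      linarith
    have h1 := hu.dist_le_mul (t (k + 1)) s
    have h2 := hyL.dist_le_mul (t (k + 1)) s
    rw [dist_eq_norm, Real.dist_eq] at h1 h2
    have h3 : (L : ℝ) * |t (k + 1) - s| ≤ L * h := by gcongr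
    rw [e]
    exact (norm_sub_le _ _).trans (by linarith)
  · have := hdz k z hz
    rw [hg, inner_smul_left]
    simp only [conj_trivial]
    rw [inv_mul_le_iff₀ hh]
    refine this.trans (le_of_eq ?_)
    ring

/-- The distance of two approximate solutions is controlled by the sum of their errors. -/
lemma IsApproxSolution.norm_sub_sq_le [CompleteSpace H] (hr : 0 < r) {T : ℝ} (hT : 0 ≤ T)
    {ε₁ ε₂ : ℝ} {y₁ g₁ y₂ g₂ : ℝ → H} (h₁ : IsApproxSolution r L ε₁ Z u z₀ y₁ g₁)
    (h₂ : IsApproxSolution r L ε₂ Z u z₀ y₂ g₂) {δ : ℝ} (hδ : ε₁ + ε₂ ≤ δ) (hδ0 : 0 ≤ δ)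
    {t : ℝ} (ht : t ∈ Icc 0 T) :
    ‖y₁ t - y₂ t‖ ^ 2 ≤
      2 * ((4 * L / r * δ ^ 2 + 4 * L * δ) * T) * Real.exp (2 * (4 * L / r * T)) := by
  set C : ℝ := 4 * L / r * δ ^ 2 + 4 * L * δ with hC
  have hC0 : 0 ≤ C := by positivity
  have hpt : ∀ s, 0 ≤ s → 2 * inner ℝ (y₁ s - y₂ s) (g₁ s - g₂ s) ≤
      C + 4 * L / r * ‖y₁ s - y₂ s‖ ^ 2 := by
    intro s hs
    obtain ⟨x₁, hx₁, he₁, hn₁⟩ := h₁.normal s hs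
    obtain ⟨x₂, hx₂, he₂, hn₂⟩ := h₂.normal s hs
    set D := y₁ s - y₂ s with hD
    set e := (x₂ - (u s - y₂ s)) - (x₁ - (u s - y₁ s)) with he
    have hen : ‖e‖ ≤ δ := (norm_sub_le _ _).trans (by linarith)
    have hx : x₂ - x₁ = D + e := by rw [hD, he]; abel
    have i₁ := hn₁ x₂ hx₂
    have i₂ := hn₂ x₁ hx₁
    rw [← neg_sub x₂ x₁, inner_neg_right, norm_neg] at i₂
    rw [hx] at i₁ i₂
    have i₃ : inner ℝ (g₁ s - g₂ s) (D + e) ≤ L / r * ‖D + e‖ ^ 2 := by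
      rw [inner_sub_left]
      have : (L : ℝ) / r = L / (2 * r) + L / (2 * r) := by field_simp; norm_num
      rw [this]
      linarith
    have i₄ : ‖D + e‖ ^ 2 ≤ 2 * ‖D‖ ^ 2 + 2 * δ ^ 2 := by
      have a1 : ‖D + e‖ ^ 2 ≤ (‖D‖ + δ) ^ 2 := by
        gcongr
        exact (norm_add_le _ _).trans (by linarith)
      nlinarith [sq_nonneg (‖D‖ - δ)]
    have i₅ : -(2 * L * δ) ≤ inner ℝ (g₁ s - g₂ s) e := by
      have a1 := (abs_le.1 (abs_real_inner_le_norm (g₁ s - g₂ s) e)).1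
      have a2 : ‖g₁ s - g₂ s‖ ≤ 2 * L :=
        (norm_sub_le _ _).trans (by linarith [h₁.norm_le s, h₂.norm_le s])
      have a3 : ‖g₁ s - g₂ s‖ * ‖e‖ ≤ 2 * L * δ := by gcongr
      linarith
    rw [inner_add_right] at i₃
    have i₆ : (L : ℝ) / r * ‖D + e‖ ^ 2 ≤ L / r * (2 * ‖D‖ ^ 2 + 2 * δ ^ 2) := by gcongr
    rw [real_inner_comm]
    have e1 : C + 4 * L / r * ‖D‖ ^ 2 = 2 * (L / r * (2 * ‖D‖ ^ 2 + 2 * δ ^ 2)) + 4 * L * δ := by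
      rw [hC]; ring
    rw [e1]
    linarith
  have hD : Continuous fun s => y₁ s - y₂ s :=
    h₁.lipschitzWith.continuous.sub h₂.lipschitzWith.continuous
  have key : ∀ s ∈ Icc 0 T, ‖y₁ s - y₂ s‖ ^ 2 ≤
      C * T + ∫ τ in 0..s, 4 * L / r * ‖y₁ τ - y₂ τ‖ ^ 2 := by
    intro s hs
    have hch := norm_sq_sub_norm_sq_eq_integral (ν := volume) hs.1 (w := fun s => y₁ s - y₂ s)
      (h := fun s => g₁ s - g₂ s) hD.continuousOn
      ((h₁.intervalIntegrable 0 s).sub (h₂.intervalIntegrable 0 s)) fun a b _ _ _ => by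
        rw [intervalIntegral.integral_sub (h₁.intervalIntegrable a b) (h₂.intervalIntegrable a b),
          ← h₁.sub_eq_integral, ← h₂.sub_eq_integral]
        abel
    have h0 : y₁ 0 - y₂ 0 = 0 := by simp [h₁.eq_primitive, h₂.eq_primitive]
    have hRi : IntervalIntegrable (fun τ => C + 4 * L / r * ‖y₁ τ - y₂ τ‖ ^ 2) volume 0 s :=
      (continuous_const.add (continuous_const.mul (hD.norm.pow 2))).intervalIntegrable _ _
    have hLi : IntervalIntegrable (fun τ => 2 * inner ℝ (y₁ τ - y₂ τ) (g₁ τ - g₂ τ))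
        volume 0 s := by
      refine IntervalIntegrable.const_mul ?_ 2
      obtain ⟨M, hM⟩ := (isCompact_Icc (a := 0) (b := s)).exists_bound_of_continuousOn
        hD.continuousOn
      refine (intervalIntegrable_const (c := M * (2 * L))).mono_fun
        (hD.aestronglyMeasurable.inner
          (h₁.stronglyMeasurable.sub h₂.stronglyMeasurable).aestronglyMeasurable) ?_
      refine (ae_restrict_iff' measurableSet_uIoc).2 (ae_of_all _ fun τ hτ => ?_)
      rw [uIoc_of_le hs.1] at hτ
      have a1 := hM τ (Ioc_subset_Icc_self hτ)
      have a2 : ‖g₁ τ - g₂ τ‖ ≤ 2 * L :=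
        (norm_sub_le _ _).trans (by linarith [h₁.norm_le τ, h₂.norm_le τ])
      refine (norm_inner_le_norm _ _).trans ?_
      refine le_trans ?_ (le_abs_self _)
      gcongr
      exact (norm_nonneg _).trans a1
    have hle : ∫ τ in 0..s, 2 * inner ℝ (y₁ τ - y₂ τ) (g₁ τ - g₂ τ) ≤
        ∫ τ in 0..s, (C + 4 * L / r * ‖y₁ τ - y₂ τ‖ ^ 2) :=
      intervalIntegral.integral_mono_on hs.1 hLi hRi fun τ hτ => hpt τ hτ.1
    have hRi' : IntervalIntegrable (fun τ => 4 * L / r * ‖y₁ τ - y₂ τ‖ ^ 2) volume 0 s :=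
      (continuous_const.mul (hD.norm.pow 2)).intervalIntegrable _ _
    rw [intervalIntegral.integral_add intervalIntegrable_const hRi',
      intervalIntegral.integral_const, intervalIntegral.integral_const_mul, ← hch] at hle
    simp only [h0, norm_zero, sub_zero, smul_eq_mul] at hle
    have : s * C ≤ C * T := by
      rw [mul_comm]
      exact mul_le_mul_of_nonneg_left hs.2 hC0
    linarith
  have := gronwall_of_integral_le (ν := volume) hT (a := fun _ => 4 * L / r)
    (F := fun t => ‖y₁ t - y₂ t‖ ^ 2) (C := C * T) (fun _ => by positivity)
    intervalIntegrable_const (hD.norm.pow 2).continuousOn key ht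
  rw [abs_of_nonneg (by positivity), intervalIntegral.integral_const, sub_zero, smul_eq_mul,
    mul_comm T] at this
  exact this

end Approximation

/-! ### Existence of strong solutions -/

section Existence

variable {H : Type*} [NormedAddCommGroup H] [InnerProductSpace ℝ H] {r T : ℝ} {L : ℝ≥0}
  {Z : Set H} {u : ℝ → H} {z₀ : H} {y : ℝ → H}

/-- The pointwise (differential) form of the play problem for Lipschitz functions: `y'` is a
proximal normal to `Z` at `u - y` almost everywhere. -/
structure IsStrongSolution (T r : ℝ) (Z : Set H) (u : ℝ → H) (z₀ : H) (y : ℝ → H) : Prop where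
  isLip : IsLip T y
  sub_mem : ∀ t ∈ Icc 0 T, u t - y t ∈ Z
  initial : u 0 - y 0 = z₀
  normal : ∀ᵐ t ∂volume.restrict (Icc 0 T), ∀ z ∈ Z,
    inner ℝ (deriv y t) (z - (u t - y t)) ≤ ‖deriv y t‖ / (2 * r) * ‖z - (u t - y t)‖ ^ 2

/-- The normal inequality for the increments of an approximate solution `yn`, taken at a point
`u t - y t` near the curve `u - yn`. -/
lemma IsApproxSolution.inner_sub_le [CompleteSpace H] (hr : 0 < r) (hu : LipschitzWith L u)
    {ε η : ℝ} {yn gn : ℝ → H} (h : IsApproxSolution r L ε Z u z₀ yn gn) {t s : ℝ}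
    (ht : 0 ≤ t) (hts : t ≤ s)
    (hη : ‖yn t - y t‖ ≤ η) {z : H} (hz : z ∈ Z) :
    inner ℝ (yn s - yn t) (z - (u t - y t)) ≤ (s - t) *
      (L / (2 * r) * (‖z - (u t - y t)‖ + (ε + η + 2 * L * (s - t))) ^ 2 +
        L * (ε + η + 2 * L * (s - t))) := by
  set x := u t - y t with hx
  set δ := ε + η + 2 * L * (s - t) with hδ
  have hpt : ∀ τ ∈ Icc t s, inner ℝ (gn τ) (z - x) ≤
      L / (2 * r) * (‖z - x‖ + δ) ^ 2 + L * δ := by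
    intro τ hτ
    obtain ⟨x', hx', he, hn⟩ := h.normal τ (ht.trans hτ.1)
    have hxx : ‖x' - x‖ ≤ δ := by
      have e : x' - x = (x' - (u τ - yn τ)) + ((u τ - u t) - (yn τ - yn t) - (yn t - y t)) := by
        rw [hx]; abel
      have h1 := hu.dist_le_mul τ t
      have h2 := h.lipschitzWith.dist_le_mul τ t
      rw [dist_eq_norm, Real.dist_eq, abs_of_nonneg (sub_nonneg.2 hτ.1)] at h1 h2
      have h3 : (L : ℝ) * (τ - t) ≤ L * (s - t) := by gcongr; exact hτ.2
      rw [e]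
      refine (norm_add_le _ _).trans ?_
      have h4 := (norm_sub_le ((u τ - u t) - (yn τ - yn t)) (yn t - y t))
      have h5 := norm_sub_le (u τ - u t) (yn τ - yn t)
      rw [hδ]
      linarith
    have h1 := hn z hz
    have h2 : ‖z - x'‖ ≤ ‖z - x‖ + δ := by
      rw [show z - x' = (z - x) - (x' - x) by abel]
      exact (norm_sub_le _ _).trans (by linarith)
    have h3 : (L : ℝ) / (2 * r) * ‖z - x'‖ ^ 2 ≤ L / (2 * r) * (‖z - x‖ + δ) ^ 2 := by gcongr
    have h4 : inner ℝ (gn τ) (x' - x) ≤ L * δ := by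
      refine (real_inner_le_norm _ _).trans ?_
      have := h.norm_le τ
      gcongr
    have h5 : inner ℝ (gn τ) (z - x) = inner ℝ (gn τ) (z - x') + inner ℝ (gn τ) (x' - x) := by
      rw [← inner_add_right]
      congr 1
      abel
    linarith
  have hgi := h.intervalIntegrable t s
  have e1 : inner ℝ (yn s - yn t) (z - x) = ∫ τ in t..s, inner ℝ (gn τ) (z - x) := by
    rw [h.sub_eq_integral t s, real_inner_comm]
    have := ((innerSL ℝ (z - x)).intervalIntegral_comp_comm hgi).symm
    simp only [innerSL_apply_apply] at this
    rw [this]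
    congr 1 with τ
    rw [real_inner_comm]
  have hi : IntervalIntegrable (fun τ => inner ℝ (gn τ) (z - x)) volume t s :=
    ⟨hgi.1.inner_const _, hgi.2.inner_const _⟩
  rw [e1]
  refine (intervalIntegral.integral_mono_on hts hi intervalIntegrable_const hpt).trans (le_of_eq ?_)
  rw [intervalIntegral.integral_const, smul_eq_mul]

variable [CompleteSpace H]

/-- Approximate solutions with errors tending to zero converge to a strong solution. -/
lemma IsProxRegular.exists_isStrongSolution_of_lipschitzWith (hZ : IsProxRegular r Z) (hr : 0 < r)
    (hT : 0 ≤ T) (hu : LipschitzWith L u) (hz₀ : z₀ ∈ Z) :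
    ∃ y, IsStrongSolution T r Z u z₀ y := by
  set ε : ℕ → ℝ := fun n => 1 / ((n : ℝ) + 1) with hε
  have hε0 : ∀ n, 0 < ε n := fun n => Nat.one_div_pos_of_nat
  have hεlim : Tendsto ε atTop (𝓝 0) := tendsto_one_div_add_atTop_nhds_zero_nat
  have hεanti : ∀ n m, n ≤ m → ε m ≤ ε n := fun n m hnm => Nat.one_div_le_one_div hnm
  choose Y G hYG using fun n => hZ.exists_isApproxSolution hr hu hz₀ (hε0 n)
  set η : ℕ → ℝ := fun n => √(2 * ((4 * L / r * (2 * ε n) ^ 2 + 4 * L * (2 * ε n)) * T) *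
    Real.exp (2 * (4 * L / r * T))) with hη
  have hηlim : Tendsto η atTop (𝓝 0) := by
    have hc : Continuous fun e : ℝ => √(2 * ((4 * L / r * (2 * e) ^ 2 + 4 * L * (2 * e)) * T) *
      Real.exp (2 * (4 * L / r * T))) := by fun_prop
    have := (hc.tendsto 0).comp hεlim
    simpa using! this
  have hYY : ∀ n m, n ≤ m → ∀ t ∈ Icc 0 T, ‖Y n t - Y m t‖ ≤ η n := fun n m hnm t ht =>
    Real.le_sqrt_of_sq_le ((hYG n).norm_sub_sq_le hr hT (hYG m)
      (by linarith [hεanti n m hnm]) (by linarith [hε0 n]) ht)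
  have hlim : ∀ t, ∃ l, t ∈ Icc 0 T → Tendsto (fun n => Y n t) atTop (𝓝 l) := by
    intro t
    by_cases ht : t ∈ Icc 0 T
    · have hcau : CauchySeq fun n => Y n t := by
        refine cauchySeq_of_le_tendsto_0' η (fun n m hnm => ?_) hηlim
        rw [dist_eq_norm]
        exact hYY n m hnm t ht
      obtain ⟨l, hl⟩ := cauchySeq_tendsto_of_complete hcau
      exact ⟨l, fun _ => hl⟩
    · exact ⟨0, fun h => absurd h ht⟩
  choose y hy using hlim
  have hYy : ∀ n, ∀ t ∈ Icc 0 T, ‖Y n t - y t‖ ≤ η n := fun n t ht =>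
    le_of_tendsto (tendsto_const_nhds.sub (hy t ht)).norm
      (by filter_upwards [eventually_ge_atTop n] with m hm using hYY n m hm t ht)
  have hyL : LipschitzOnWith L y (Icc 0 T) := by
    refine LipschitzOnWith.of_dist_le_mul fun s hs t ht => ?_
    exact le_of_tendsto ((hy s hs).dist (hy t ht))
      (Eventually.of_forall fun n => (hYG n).lipschitzWith.dist_le_mul s t)
  have hmem : ∀ t ∈ Icc 0 T, u t - y t ∈ Z := by
    intro t ht
    choose x hx he _ using fun n => (hYG n).normal t ht.1
    have h1 : Tendsto (fun n => x n - (u t - Y n t)) atTop (𝓝 0) :=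
      squeeze_zero_norm he hεlim
    have h2 : Tendsto x atTop (𝓝 (u t - y t)) := by
      have := h1.add (tendsto_const_nhds.sub (hy t ht) : Tendsto (fun n => u t - Y n t) atTop _)
      simpa using this
    exact hZ.isClosed.mem_of_tendsto h2 (Eventually.of_forall hx)
  refine ⟨y, ⟨L, hyL⟩, hmem, ?_, ?_⟩
  · have h0 := hy 0 ⟨le_rfl, hT⟩
    have : ∀ n, Y n 0 = u 0 - z₀ := fun n => by simp [(hYG n).eq_primitive]
    simp only [this] at h0
    rw [tendsto_nhds_unique h0 tendsto_const_nhds, sub_sub_cancel]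
  -- the normal inequality for difference quotients of approximate solutions passes to the limit
  have hneT : ∀ᵐ t ∂volume.restrict (Icc 0 T), t ≠ T :=
    ae_restrict_of_ae (by simp [ae_iff])
  filter_upwards [ae_hasDerivAt_of_lipschitzOn hT hyL, ae_restrict_mem measurableSet_Icc, hneT]
    with t hd ht htT z hz
  -- it suffices to have the normal inequality with some constant
  refine hZ.inner_le_of_forall_inner_le hr (hmem t ht) (M := L / (2 * r)) (fun z hz => ?_) hz
  set x := u t - y t with hx
  have hts : ∀ s ∈ Ioc t T, inner ℝ (y s - y t) (z - x) ≤ (s - t) *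
      (L / (2 * r) * (‖z - x‖ + (0 + 0 + 2 * L * (s - t))) ^ 2 +
        L * (0 + 0 + 2 * L * (s - t))) := by
    intro s hs
    have hsT : s ∈ Icc 0 T := ⟨ht.1.trans hs.1.le, hs.2⟩
    have h1 := ((hy s hsT).sub (hy t ht)).inner (𝕜 := ℝ) (tendsto_const_nhds (x := z - x))
    have h2 : Continuous fun p : ℝ × ℝ => (s - t) *
      (L / (2 * r) * (‖z - x‖ + (p.1 + p.2 + 2 * L * (s - t))) ^ 2 +
        L * (p.1 + p.2 + 2 * L * (s - t))) := by fun_prop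
    have h3 := (h2.tendsto (0, 0)).comp (hεlim.prodMk_nhds hηlim)
    exact le_of_tendsto_of_tendsto' h1 h3 fun n =>
      (hYG n).inner_sub_le hr hu ht.1 hs.1.le (hYy n t ht) hz
  have hslope := (hasDerivAt_iff_tendsto_slope.1 hd).mono_left
    (nhdsWithin_mono t (fun s hs => ne_of_gt hs : Ioi t ⊆ {t}ᶜ))
  have hL := hslope.inner (𝕜 := ℝ) (tendsto_const_nhds (x := z - x))
  have hR : Tendsto (fun s => L / (2 * r) * (‖z - x‖ + (0 + 0 + 2 * L * (s - t))) ^ 2 +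
        L * (0 + 0 + 2 * L * (s - t))) (𝓝[>] t) (𝓝 (L / (2 * r) * ‖z - x‖ ^ 2)) := by
    have hc : Continuous fun s => L / (2 * r) * (‖z - x‖ + (0 + 0 + 2 * L * (s - t))) ^ 2 +
        L * (0 + 0 + 2 * L * (s - t)) := by fun_prop
    have := (hc.tendsto t).mono_left (nhdsWithin_le_nhds (s := Ioi t))
    simpa using this
  refine le_of_tendsto_of_tendsto hL hR ?_
  filter_upwards [Ioc_mem_nhdsGT (ht.2.lt_of_ne htT)] with s hs
  rw [slope_def_module, inner_smul_left]
  simp only [conj_trivial]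
  rw [inv_mul_le_iff₀ (sub_pos.2 hs.1)]
  exact hts s hs

lemma IsProxRegular.exists_isStrongSolution (hZ : IsProxRegular r Z) (hr : 0 < r)
    (hT : 0 ≤ T) (hu : IsLip T u) (hz₀ : z₀ ∈ Z) : ∃ y, IsStrongSolution T r Z u z₀ y := by
  obtain ⟨L, hL⟩ := hu
  have hext : LipschitzWith L (constExtend hT u) := by
    have h1 : LipschitzWith L (fun t : Icc 0 T => u t) := hL.to_restrict
    have h2 := h1.comp (LipschitzWith.projIcc hT)
    rwa [mul_one] at h2
  obtain ⟨y, h1, h2, h3, h4⟩ := hZ.exists_isStrongSolution_of_lipschitzWith hr hT hext hz₀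
  have he : ∀ t ∈ Icc 0 T, constExtend hT u t = u t := fun t ht => constExtend_of_mem hT u ht
  refine ⟨y, h1, fun t ht => he t ht ▸ h2 t ht, he 0 ⟨le_rfl, hT⟩ ▸ h3, ?_⟩
  filter_upwards [h4, ae_restrict_mem measurableSet_Icc] with t ht htm
  rwa [he t htm] at ht

/-- Strong solutions solve the play problem: `Dy` and `|Dy|` have densities `y'` and `‖y'‖`, so the
variational inequality is the integral of the pointwise one. -/
lemma IsStrongSolution.isPlaySolution (hr : 0 < r) (hT : 0 ≤ T) (hu : IsLip T u)
    (h : IsStrongSolution T r Z u z₀ y) : IsPlaySolution hT r Z u z₀ y := by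
  obtain ⟨L, hL⟩ := h.isLip
  obtain ⟨L', hL'⟩ := hu
  refine ⟨hL.continuousOn, hL.boundedVariationOn_Icc, h.sub_mem, fun z hz hzZ => ?_, h.initial⟩
  set m := differentialMeasure hT hL.boundedVariationOn_Icc with hm
  set φ : ℝ → H := fun t => z t - u t + y t with hφ
  have hRHS : 0 ≤ 1 / (2 * r) * ∫ t in Icc 0 T, ‖φ t‖ ^ 2 ∂m.variation :=
    mul_nonneg (by positivity) (integral_nonneg fun t => by positivity)
  -- Functions of bounded variation are integrable, but this is not needed here: the right-hand side
  -- is nonnegative, and without integrability the left-hand side is zero by convention.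
  by_cases hint : (m.restrict (Icc 0 T)).Integrable φ
  swap
  · rw [VectorMeasure.integral_undef hint]
    exact hRHS
  have hint' : Integrable ((Icc 0 T).indicator φ) m.variation :=
    (VectorMeasure.integrable_indicator_iff measurableSet_Icc).2 hint
  have hvar : m.variation = (volume.restrict (Icc 0 T)).withDensity fun t => ‖deriv y t‖ₑ :=
    variation_differentialMeasure_of_lipschitzOn hT hL _
  have hdm : Measurable fun t => ‖deriv y t‖ₑ := (stronglyMeasurable_deriv y).enorm
  have hLHS : ∫ᵛ t in Icc 0 T, φ t ∂[innerSL ℝ; m] = ∫ t in Icc 0 T, inner ℝ (φ t) (deriv y t) := by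
    rw [VectorMeasure.setIntegral_congr_fun
      (fun t ht => (indicator_of_mem ht φ).symm : EqOn φ ((Icc 0 T).indicator φ) (Icc 0 T)),
      integral_differentialMeasure_of_lipschitzOn hT hL _ hint']
    exact setIntegral_congr_fun measurableSet_Icc fun t ht => by simp only [indicator_of_mem ht]
  rw [hLHS]
  by_cases hint2 : IntegrableOn (fun t => inner ℝ (φ t) (deriv y t)) (Icc 0 T)
  swap
  · rw [integral_undef hint2]
    exact hRHS
  have hbdd : ∃ C, ∀ t ∈ Icc 0 T, ‖φ t‖ ≤ C := by
    obtain ⟨C, hC⟩ := isCompact_Icc.exists_bound_of_continuousOn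
      (hL.continuousOn.sub hL'.continuousOn)
    refine ⟨(eVariationOn z (Icc 0 T)).toReal + ‖z 0‖ + C, fun t ht => ?_⟩
    have h1 := hz.dist_le ht (⟨le_rfl, hT⟩ : (0 : ℝ) ∈ Icc 0 T)
    rw [dist_eq_norm] at h1
    have h2 := hC t ht
    have h3 : φ t = (z t - z 0) + z 0 + (y t - u t) := by simp only [hφ]; abel
    rw [h3]
    exact (norm_add₃_le).trans (by simp only [Pi.sub_apply] at h2; linarith)
  obtain ⟨C, hC⟩ := hbdd
  have hrestr : m.variation.restrict (Icc 0 T) = m.variation := by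
    rw [hvar, restrict_withDensity measurableSet_Icc, Measure.restrict_restrict measurableSet_Icc,
      inter_self]
  have hφi : Integrable φ (m.variation.restrict (Icc 0 T)) :=
    (integrable_indicator_iff measurableSet_Icc).1 hint'
  have hsq : Integrable (fun t => ‖φ t‖ ^ 2) (m.variation.restrict (Icc 0 T)) := by
    refine (hφi.norm.const_mul C).mono' (hφi.1.norm.pow 2) ?_
    refine (ae_restrict_iff' measurableSet_Icc).2 (ae_of_all _ fun t ht => ?_)
    rw [norm_pow, norm_norm, pow_two]
    gcongr
    exact hC t ht
  rw [hrestr] at hsq ⊢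
  rw [hvar, integrable_withDensity_iff_integrable_smul' hdm (by simp)] at hsq
  rw [hvar, integral_withDensity_eq_integral_toReal_smul hdm (by simp), ← integral_const_mul]
  refine integral_mono_ae hint2 (hsq.const_mul _) ?_
  filter_upwards [h.normal, ae_restrict_mem measurableSet_Icc] with t ht htm
  have e : z t - u t + y t = z t - (u t - y t) := by abel
  simp only [hφ, e, toReal_enorm, smul_eq_mul]
  rw [real_inner_comm]
  refine (ht (z t) (hzZ t htm)).trans (le_of_eq ?_)
  ring

end Existence

/-! ### Orthogonality and continuous dependence in the supremum norm -/

section StrongSolutions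

variable {H : Type*} [NormedAddCommGroup H] [InnerProductSpace ℝ H] {r T : ℝ}
  {Z : Set H} {u : ℝ → H} {z₀ : H} {y : ℝ → H}

lemma ae_mem_Ioo : ∀ᵐ t ∂volume.restrict (Icc 0 T), t ∈ Ioo 0 T := by
  have h0 : ∀ᵐ t ∂volume.restrict (Icc 0 T), t ≠ 0 := ae_restrict_of_ae (by simp [ae_iff])
  have h1 : ∀ᵐ t ∂volume.restrict (Icc 0 T), t ≠ T := ae_restrict_of_ae (by simp [ae_iff])
  filter_upwards [ae_restrict_mem measurableSet_Icc, h0, h1] with t ht h0 h1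
  exact ⟨ht.1.lt_of_ne' h0, ht.2.lt_of_ne h1⟩

/-- Being a strong solution depends only on the values on `[0, T]`: the derivatives agree in the
interior. -/
lemma IsStrongSolution.congr {y' : ℝ → H} (hT : 0 ≤ T) (h : IsStrongSolution T r Z u z₀ y)
    (he : EqOn y' y (Icc 0 T)) : IsStrongSolution T r Z u z₀ y' := by
  obtain ⟨⟨L, hL⟩, h2, h3, h4⟩ := h
  refine ⟨⟨L, fun s hs t ht => by rw [he hs, he ht]; exact hL hs ht⟩,
    fun t ht => by rw [he ht]; exact h2 t ht, by rw [he ⟨le_rfl, hT⟩]; exact h3, ?_⟩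
  filter_upwards [h4, ae_mem_Ioo] with t ht htm
  have hd : deriv y' t = deriv y t := Filter.EventuallyEq.deriv_eq (by
    filter_upwards [Ioo_mem_nhds htm.1 htm.2] with s hs using he (Ioo_subset_Icc_self hs))
  rw [hd, he (Ioo_subset_Icc_self htm)]
  exact ht

/-- Reflecting `a` along an orthogonal component `b` preserves the norm. -/
lemma norm_sub_two_smul_eq {a b : H} (h : inner ℝ b (a - b) = 0) :
    ‖a - (2 : ℝ) • b‖ = ‖a‖ := by
  rw [inner_sub_right, real_inner_self_eq_norm_sq] at h
  have h1 : ‖a - (2 : ℝ) • b‖ ^ 2 = ‖a‖ ^ 2 := by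
    rw [norm_sub_sq_real, inner_smul_right, norm_smul, real_inner_comm, Real.norm_ofNat]
    linarith
  exact (sq_eq_sq₀ (norm_nonneg _) (norm_nonneg _)).1 h1

lemma norm_le_of_inner_sub_eq_zero {a b : H} (h : inner ℝ b (a - b) = 0) : ‖b‖ ≤ ‖a‖ := by
  have h1 : b = (1 / 2 : ℝ) • (a - (a - (2 : ℝ) • b)) := by
    rw [sub_sub_cancel, smul_smul]; norm_num
  have h2 := norm_sub_le a (a - (2 : ℝ) • b)
  rw [norm_sub_two_smul_eq h] at h2
  have h3 := congrArg norm h1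
  rw [norm_smul, Real.norm_of_nonneg (by norm_num)] at h3
  linarith

variable [CompleteSpace H]

/-- The velocity `y'` is orthogonal to `u' - y'`: being a proximal normal at `x = u - y`, it makes
`⟪y'(t), x(s) - x(t)⟫ - C ‖x(s) - x(t)‖²` maximal at `s = t`. -/
lemma IsStrongSolution.ae_inner_deriv_eq_zero (hT : 0 ≤ T) (hu : IsLip T u)
    (h : IsStrongSolution T r Z u z₀ y) :
    ∀ᵐ t ∂volume.restrict (Icc 0 T), inner ℝ (deriv y t) (deriv u t - deriv y t) = 0 := by
  obtain ⟨L, hL⟩ := h.isLip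
  obtain ⟨L', hL'⟩ := hu
  filter_upwards [h.normal, ae_mem_Ioo, ae_hasDerivAt_of_lipschitzOn hT hL,
    ae_hasDerivAt_of_lipschitzOn hT hL'] with t hn ht hy hu
  set C := ‖deriv y t‖ / (2 * r) with hC
  set n := deriv y t with hn'
  have hx : HasDerivAt (fun s => (u s - y s) - (u t - y t)) (deriv u t - n) t :=
    (hu.sub hy).sub_const _
  have hq : HasDerivAt (fun s => inner ℝ n ((u s - y s) - (u t - y t)) -
      C * ‖(u s - y s) - (u t - y t)‖ ^ 2) (inner ℝ n (deriv u t - n)) t := by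
    have h1 := (hasDerivAt_const t n).inner ℝ hx
    have h2 := (hx.norm_sq).const_mul C
    exact (h1.sub h2).congr_deriv (by simp)
  have hmax : IsLocalMax (fun s => inner ℝ n ((u s - y s) - (u t - y t)) -
      C * ‖(u s - y s) - (u t - y t)‖ ^ 2) t := by
    filter_upwards [Ioo_mem_nhds ht.1 ht.2] with s hs
    have := hn (u s - y s) (h.sub_mem s (Ioo_subset_Icc_self hs))
    simp only [sub_self, inner_zero_right, norm_zero]
    linarith
  exact hmax.hasDerivAt_eq_zero hq

/-- Continuous dependence, in the supremum norm, of `u - y` on the data. The constant involves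
the derivatives of the inputs only through their `L¹` norms. -/
lemma IsStrongSolution.norm_sub_sq_le (hT : 0 ≤ T) (hr : 0 < r) {u₁ u₂ y₁ y₂ : ℝ → H} {z₁ z₂ : H}
    (hu₁ : IsLip T u₁) (hu₂ : IsLip T u₂) (h₁ : IsStrongSolution T r Z u₁ z₁ y₁)
    (h₂ : IsStrongSolution T r Z u₂ z₂ y₂) {A B E : ℝ} (hA : ∫ t in Icc 0 T, ‖deriv u₁ t‖ = A)
    (hB : ∫ t in Icc 0 T, ‖deriv u₁ t - deriv u₂ t‖ = B)
    (hE : E = Real.exp (2 * ((2 * A + B) / r))) {t : ℝ} (ht : t ∈ Icc 0 T) :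
    ‖(u₁ t - y₁ t) - (u₂ t - y₂ t)‖ ^ 2 ≤ 4 * E * ‖z₁ - z₂‖ ^ 2 + 16 * E ^ 2 * B ^ 2 := by
  have hort₁ := h₁.ae_inner_deriv_eq_zero hT hu₁
  have hort₂ := h₂.ae_inner_deriv_eq_zero hT hu₂
  obtain ⟨K₁, hK₁⟩ := hu₁
  obtain ⟨K₂, hK₂⟩ := hu₂
  obtain ⟨L₁, hL₁⟩ := h₁.isLip
  obtain ⟨L₂, hL₂⟩ := h₂.isLip
  set w : ℝ → H := fun t => (u₁ t - y₁ t) - (u₂ t - y₂ t) with hw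
  set w' : ℝ → H := fun t => (deriv u₁ t - deriv y₁ t) - (deriv u₂ t - deriv y₂ t) with hw'
  have hwc : ContinuousOn w (Icc 0 T) :=
    (hK₁.continuousOn.sub hL₁.continuousOn).sub (hK₂.continuousOn.sub hL₂.continuousOn)
  have hIu₁ := integrableOn_deriv_of_lipschitzOn hT hK₁
  have hIu₂ := integrableOn_deriv_of_lipschitzOn hT hK₂
  have hIy₁ := integrableOn_deriv_of_lipschitzOn hT hL₁
  have hIy₂ := integrableOn_deriv_of_lipschitzOn hT hL₂
  have hIw : IntegrableOn w' (Icc 0 T) := (hIu₁.sub hIy₁).sub (hIu₂.sub hIy₂)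
  have hIIw : IntervalIntegrable w' volume 0 T :=
    (intervalIntegrable_iff_integrableOn_Icc_of_le hT).2 hIw
  have hinc : ∀ a b, 0 ≤ a → a ≤ b → b ≤ T → w b - w a = ∫ t in a..b, w' t := by
    intro a b ha hab hb
    have hs : Ioc a b ⊆ Icc 0 T := fun s hs => ⟨ha.trans hs.1.le, hs.2.trans hb⟩
    have i₁ : IntegrableOn (fun t => deriv u₁ t - deriv y₁ t) (Ioc a b) :=
      (hIu₁.sub hIy₁).mono_set hs
    have i₂ : IntegrableOn (fun t => deriv u₂ t - deriv y₂ t) (Ioc a b) :=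
      (hIu₂.sub hIy₂).mono_set hs
    simp only [hw']
    rw [intervalIntegral.integral_of_le hab, integral_sub i₁ i₂,
      integral_sub (hIu₁.mono_set hs) (hIy₁.mono_set hs),
      integral_sub (hIu₂.mono_set hs) (hIy₂.mono_set hs),
      integral_deriv_of_lipschitzOn hT hK₁ ha hab hb,
      integral_deriv_of_lipschitzOn hT hK₂ ha hab hb,
      integral_deriv_of_lipschitzOn hT hL₁ ha hab hb,
      integral_deriv_of_lipschitzOn hT hL₂ ha hab hb]
    simp only [hw]
    abel
  set a : ℝ → ℝ := fun t => (‖deriv u₁ t‖ + ‖deriv u₂ t‖) / r with ha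
  have haI : IntegrableOn a (Icc 0 T) := (hIu₁.norm.add hIu₂.norm).div_const r
  have ha0 : ∀ t, 0 ≤ a t := fun t => by positivity
  -- the maximum of `‖w‖`
  obtain ⟨τ, hτ, hmax⟩ := isCompact_Icc.exists_isMaxOn ⟨t, ht⟩ hwc.norm
  set M := ‖w τ‖ with hM
  have hMle : ∀ s ∈ Icc 0 T, ‖w s‖ ≤ M := fun s hs => hmax hs
  have hM0 : 0 ≤ M := norm_nonneg _
  have hpt : ∀ᵐ s ∂volume.restrict (Icc 0 T), 2 * inner ℝ (w s) (w' s) ≤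
      2 * M * ‖deriv u₁ s - deriv u₂ s‖ + a s * ‖w s‖ ^ 2 := by
    filter_upwards [h₁.normal, h₂.normal, hort₁, hort₂, ae_restrict_mem measurableSet_Icc]
      with s n₁ n₂ o₁ o₂ hs
    have i₁ := n₁ _ (h₂.sub_mem s hs)
    have i₂ := n₂ _ (h₁.sub_mem s hs)
    have b₁ := norm_le_of_inner_sub_eq_zero o₁
    have b₂ := norm_le_of_inner_sub_eq_zero o₂
    have j₁ : -inner ℝ (deriv y₁ s) (w s) ≤ ‖deriv u₁ s‖ / (2 * r) * ‖w s‖ ^ 2 := by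
      rw [← inner_neg_right, ← norm_neg (w s), show -w s = (u₂ s - y₂ s) - (u₁ s - y₁ s) by
        simp only [hw]; abel]
      exact i₁.trans (by gcongr)
    have j₂ : inner ℝ (deriv y₂ s) (w s) ≤ ‖deriv u₂ s‖ / (2 * r) * ‖w s‖ ^ 2 :=
      i₂.trans (by gcongr)
    have j₃ : inner ℝ (w s) (deriv u₁ s - deriv u₂ s) ≤ M * ‖deriv u₁ s - deriv u₂ s‖ := by
      refine (real_inner_le_norm _ _).trans ?_
      have := hMle s hs
      gcongr
    have j₄ : inner ℝ (w s) (w' s) = inner ℝ (w s) (deriv u₁ s - deriv u₂ s) -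
        inner ℝ (deriv y₁ s) (w s) + inner ℝ (deriv y₂ s) (w s) := by
      rw [real_inner_comm (w s) (deriv y₁ s), real_inner_comm (w s) (deriv y₂ s), ← inner_sub_right,
        ← inner_add_right]
      congr 1
      simp only [hw']
      abel
    have j₅ : a s * ‖w s‖ ^ 2 = 2 * (‖deriv u₁ s‖ / (2 * r) * ‖w s‖ ^ 2) +
        2 * (‖deriv u₂ s‖ / (2 * r) * ‖w s‖ ^ 2) := by
      simp only [ha]
      field_simp
    rw [j₄, j₅]
    linarith
  have hw0 : w 0 = z₁ - z₂ := by simp only [hw, h₁.initial, h₂.initial]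
  have hB0 : 0 ≤ B := hB ▸ integral_nonneg fun _ => norm_nonneg _
  have hIB : IntegrableOn (fun s => ‖deriv u₁ s - deriv u₂ s‖) (Icc 0 T) := (hIu₁.sub hIu₂).norm
  obtain ⟨Cw, hCw⟩ := isCompact_Icc.exists_bound_of_continuousOn hwc
  have hwm : AEStronglyMeasurable w (volume.restrict (Icc 0 T)) :=
    hwc.aestronglyMeasurable measurableSet_Icc
  have hIL : IntegrableOn (fun s => 2 * inner ℝ (w s) (w' s)) (Icc 0 T) := by
    refine Integrable.const_mul ((hIw.norm.const_mul Cw).mono' (hwm.inner hIw.1) ?_) 2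
    refine (ae_restrict_iff' measurableSet_Icc).2 (ae_of_all _ fun s hs => ?_)
    refine (norm_inner_le_norm _ _).trans ?_
    have := hCw s hs
    gcongr
  have hIa : IntegrableOn (fun s => a s * ‖w s‖ ^ 2) (Icc 0 T) := by
    refine (haI.norm.mul_const (Cw ^ 2)).mono' (haI.1.mul (hwm.norm.pow 2)) ?_
    refine (ae_restrict_iff' measurableSet_Icc).2 (ae_of_all _ fun s hs => ?_)
    rw [norm_mul, norm_pow, norm_norm]
    have := hCw s hs
    gcongr
  have hIB2 : IntegrableOn (fun s => 2 * M * ‖deriv u₁ s - deriv u₂ s‖) (Icc 0 T) :=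
    hIB.const_mul _
  have hIsum : IntegrableOn
      (fun s => 2 * M * ‖deriv u₁ s - deriv u₂ s‖ + a s * ‖w s‖ ^ 2) (Icc 0 T) := hIB2.add hIa
  have key : ∀ s ∈ Icc 0 T, ‖w s‖ ^ 2 ≤
      (‖z₁ - z₂‖ ^ 2 + 2 * M * B) + ∫ τ in 0..s, a τ * ‖w τ‖ ^ 2 := by
    intro s hs
    have hsub : Ioc 0 s ⊆ Icc 0 T := fun x hx => ⟨hx.1.le, hx.2.trans hs.2⟩
    have hch := norm_sq_sub_norm_sq_eq_integral (ν := volume) hs.1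
      (hwc.mono (Icc_subset_Icc le_rfl hs.2)) (hIIw.mono_Icc le_rfl hs.1 hs.2)
      fun a b ha hab hb => hinc a b ha hab (hb.trans hs.2)
    rw [← intervalIntegral.integral_const_mul, intervalIntegral.integral_of_le hs.1, hw0] at hch
    have hle : ∫ τ in Ioc 0 s, 2 * inner ℝ (w τ) (w' τ) ≤
        ∫ τ in Ioc 0 s, (2 * M * ‖deriv u₁ τ - deriv u₂ τ‖ + a τ * ‖w τ‖ ^ 2) :=
      integral_mono_ae (hIL.mono_set hsub)
        (hIsum.mono_set hsub)
        (ae_restrict_of_ae_restrict_of_subset hsub hpt)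
    rw [integral_add (hIB2.mono_set hsub) (hIa.mono_set hsub),
      integral_const_mul (2 * M)] at hle
    have hBs : ∫ τ in Ioc 0 s, ‖deriv u₁ τ - deriv u₂ τ‖ ≤ B := by
      rw [← hB]
      exact setIntegral_mono_set hIB (ae_of_all _ fun _ => norm_nonneg _)
        (LE.le.eventuallyLE hsub)
    have hBs' : 2 * M * ∫ τ in Ioc 0 s, ‖deriv u₁ τ - deriv u₂ τ‖ ≤ 2 * M * B := by gcongr
    rw [intervalIntegral.integral_of_le hs.1]
    linarith
  have hgr : M ^ 2 ≤ _ := gronwall_of_integral_le (ν := volume) hT ha0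
    ((intervalIntegrable_iff_integrableOn_Icc_of_le hT).2 haI) (hwc.norm.pow 2) key hτ
  have hexp : Real.exp (2 * ∫ s in 0..T, a s) ≤ E := by
    rw [hE]
    refine Real.exp_le_exp.2 (mul_le_mul_of_nonneg_left ?_ (by norm_num))
    rw [intervalIntegral.integral_of_le hT, ← integral_Icc_eq_integral_Ioc, integral_div,
      integral_add hIu₁.norm hIu₂.norm, hA]
    have : ∫ t in Icc 0 T, ‖deriv u₂ t‖ ≤ A + B := by
      rw [← hA, ← hB, ← integral_add hIu₁.norm hIB]
      refine integral_mono hIu₂.norm (hIu₁.norm.add hIB) fun s => ?_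
      rw [← norm_neg (deriv u₁ s - deriv u₂ s)]
      calc ‖deriv u₂ s‖ = ‖deriv u₁ s + -(deriv u₁ s - deriv u₂ s)‖ := by congr 1; abel
        _ ≤ _ := norm_add_le _ _
    exact div_le_div_of_nonneg_right (by linarith) hr.le
  have hE0 : 0 < E := hE ▸ Real.exp_pos _
  rw [abs_of_nonneg (by positivity)] at hgr
  have hM2 : M ^ 2 ≤ 2 * (‖z₁ - z₂‖ ^ 2 + 2 * M * B) * E := hgr.trans (by gcongr)
  have hfin : M ^ 2 ≤ 4 * E * ‖z₁ - z₂‖ ^ 2 + 16 * E ^ 2 * B ^ 2 := by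
    -- absorbing the term `4 E M B` into the left-hand side
    nlinarith [sq_nonneg (M - 4 * E * B)]
  have := hMle t ht
  calc ‖w t‖ ^ 2 ≤ M ^ 2 := by gcongr
    _ ≤ _ := hfin

end StrongSolutions

/-! ### From convergence of norms to strong convergence -/

section StrongConvergence

variable {H : Type*} [NormedAddCommGroup H] [InnerProductSpace ℝ H] [CompleteSpace H]
  {μ : Measure ℝ} [IsFiniteMeasure μ] {q : ℕ → ℝ → H} {M : ℝ}

/-- For a uniformly bounded sequence of functions on a finite measure space over the line,
convergence to zero of the integrals over all intervals extends to all measurable sets. -/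
lemma tendsto_setIntegral_zero_of_Ioc (hq : ∀ n, Integrable (q n) μ)
    (hM : ∀ n, ∀ᵐ t ∂μ, ‖q n t‖ ≤ M)
    (hIoc : ∀ a b, a ≤ b → Tendsto (fun n => ∫ t in Ioc a b, q n t ∂μ) atTop (𝓝 0))
    (huniv : Tendsto (fun n => ∫ t, q n t ∂μ) atTop (𝓝 0)) {s : Set ℝ} (hs : MeasurableSet s) :
    Tendsto (fun n => ∫ t in s, q n t ∂μ) atTop (𝓝 0) := by
  induction s, hs using MeasurableSpace.induction_on_inter
    (s := {S : Set ℝ | ∃ l u, l < u ∧ Ioc l u = S})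
    ((BorelSpace.measurable_eq (α := ℝ)).trans (borel_eq_generateFrom_Ioc ℝ))
    (isPiSystem_Ioc id id) with
  | empty => simp
  | basic s hs =>
    obtain ⟨a, b, hab, rfl⟩ := hs
    exact hIoc a b hab.le
  | compl s hs ih =>
    have h := huniv.sub ih
    rw [sub_zero] at h
    exact h.congr fun n => by rw [← integral_add_compl hs (hq n), add_sub_cancel_left]
  | iUnion s hd hs ih =>
    have hsum : Summable fun k => M * μ.real (s k) := by
      refine Summable.mul_left _ (ENNReal.summable_toReal ?_)
      rw [← measure_iUnion hd hs]
      exact measure_ne_top _ _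
    have h := tendsto_tsum_of_dominated_convergence (𝓕 := atTop)
      (f := fun n k => ∫ t in s k, q n t ∂μ) (g := fun _ => 0) hsum ih
      (Eventually.of_forall fun n k => norm_setIntegral_le_of_norm_le_const_ae'
        (measure_lt_top _ _) ((hM n).mono fun _ ht _ => ht))
    rw [tsum_zero] at h
    exact h.congr fun n => (integral_iUnion hs hd (hq n).integrableOn).symm

lemma integrable_inner_of_norm_le {f g : ℝ → H} (hf : Integrable f μ) (hg : Integrable g μ)
    (hM : ∀ᵐ t ∂μ, ‖g t‖ ≤ M) : Integrable (fun t => inner ℝ (f t) (g t)) μ := by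
  refine (hf.norm.mul_const M).mono' (hf.1.inner hg.1) ?_
  filter_upwards [hM] with t ht
  exact (norm_inner_le_norm _ _).trans (by gcongr)

lemma abs_integral_inner_le {f g : ℝ → H} (hf : Integrable f μ)
    (hM : ∀ᵐ t ∂μ, ‖g t‖ ≤ M) : |∫ t, inner ℝ (f t) (g t) ∂μ| ≤ M * ∫ t, ‖f t‖ ∂μ := by
  rw [mul_comm, ← integral_mul_const, ← Real.norm_eq_abs]
  refine norm_integral_le_of_norm_le (hf.norm.mul_const M) ?_
  filter_upwards [hM] with t ht
  exact (norm_inner_le_norm _ _).trans (by gcongr)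

/-- Under the same assumptions, the sequence converges to zero weakly against every integrable
function. -/
lemma tendsto_integral_inner_zero (hq : ∀ n, Integrable (q n) μ)
    (hM : ∀ n, ∀ᵐ t ∂μ, ‖q n t‖ ≤ M)
    (hs : ∀ s, MeasurableSet s → Tendsto (fun n => ∫ t in s, q n t ∂μ) atTop (𝓝 0))
    {f : ℝ → H} (hf : Integrable f μ) :
    Tendsto (fun n => ∫ t, inner ℝ (f t) (q n t) ∂μ) atTop (𝓝 0) := by
  refine Integrable.induction
    (fun f => Tendsto (fun n => ∫ t, inner ℝ (f t) (q n t) ∂μ) atTop (𝓝 0)) ?_ ?_ ?_ ?_ hf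
  · intro c s hsm _
    have h := (tendsto_const_nhds (x := c)).inner (𝕜 := ℝ) (hs s hsm)
    rw [inner_zero_right] at h
    refine h.congr fun n => ?_
    rw [← integral_inner (hq n).integrableOn, ← integral_indicator hsm]
    refine integral_congr_ae (ae_of_all _ fun t => ?_)
    by_cases ht : t ∈ s <;> simp [ht]
  · intro f g _ hf hg h₁ h₂
    have h := h₁.add h₂
    rw [add_zero] at h
    refine h.congr fun n => ?_
    rw [← integral_add (integrable_inner_of_norm_le hf (hq n) (hM n))
      (integrable_inner_of_norm_le hg (hq n) (hM n))]
    simp only [Pi.add_apply, inner_add_left]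
  · refine isClosed_of_closure_subset fun f hf => ?_
    rw [mem_ofPred_eq, Metric.tendsto_atTop]
    intro ε hε
    have hK : 0 < |M| + 1 := by positivity
    obtain ⟨g, hg, hfg⟩ := Metric.mem_closure_iff.1 hf (ε / 2 / (|M| + 1)) (by positivity)
    obtain ⟨N, hN⟩ := Metric.tendsto_atTop.1 hg (ε / 2) (by positivity)
    refine ⟨N, fun n hn => ?_⟩
    have h1 := hN n hn
    rw [Real.dist_0_eq_abs] at h1 ⊢
    have hI := (L1.integrable_coeFn f).sub (L1.integrable_coeFn g)
    have h2 : ∫ t, inner ℝ (f t) (q n t) ∂μ =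
        ∫ t, inner ℝ ((f - g : ℝ → H) t) (q n t) ∂μ + ∫ t, inner ℝ (g t) (q n t) ∂μ := by
      rw [← integral_add (integrable_inner_of_norm_le hI (hq n) (hM n))
        (integrable_inner_of_norm_le (L1.integrable_coeFn g) (hq n) (hM n))]
      simp only [Pi.sub_apply, inner_sub_left, sub_add_cancel]
    have h3 := abs_integral_inner_le hI ((hM n).mono fun t ht => ht.trans
      ((le_abs_self M).trans (le_add_of_nonneg_right zero_le_one)))
    have h4 : ∫ t, ‖(f - g : ℝ → H) t‖ ∂μ = dist f g := by
      rw [dist_eq_norm, L1.norm_eq_integral_norm]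
      refine integral_congr_ae ?_
      filter_upwards [Lp.coeFn_sub f g] with t ht
      rw [ht]
    rw [h4] at h3
    rw [lt_div_iff₀' hK] at hfg
    rw [h2]
    exact (abs_add_le _ _).trans_lt (by linarith)
  · intro f g hfg _ h
    refine h.congr fun n => integral_congr_ae ?_
    filter_upwards [hfg] with t ht
    rw [ht]

/-- A Radon--Riesz property: in a Hilbert space, convergence of the integrals over intervals
together with `L¹` convergence of the norms `‖fₙ‖ → ‖f‖` to a bounded limit implies strong `L¹`
convergence. -/
lemma tendsto_integral_norm_sub_zero {f : ℝ → H} {fn : ℕ → ℝ → H} (hf : Integrable f μ)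
    (hfM : ∀ᵐ t ∂μ, ‖f t‖ ≤ M) (hfn : ∀ n, Integrable (fn n) μ)
    (hnorm : Tendsto (fun n => ∫ t, |‖f t‖ - ‖fn n t‖| ∂μ) atTop (𝓝 0))
    (hIoc : ∀ a b, a ≤ b → Tendsto (fun n => ∫ t in Ioc a b, (fn n t - f t) ∂μ) atTop (𝓝 0))
    (huniv : Tendsto (fun n => ∫ t, (fn n t - f t) ∂μ) atTop (𝓝 0)) :
    Tendsto (fun n => ∫ t, ‖fn n t - f t‖ ∂μ) atTop (𝓝 0) := by
  -- `p n` is `fn n` with its length rescaled to that of `f`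
  set p : ℕ → ℝ → H := fun n t => (‖f t‖ / ‖fn n t‖) • fn n t with hp
  have hpn : ∀ n t, ‖p n t‖ ≤ ‖f t‖ := by
    intro n t
    by_cases h0 : fn n t = 0
    · simp [hp, h0]
    · have := norm_ne_zero_iff.2 h0
      simp only [hp, norm_smul, norm_div, norm_norm]
      rw [div_mul_cancel₀ _ this]
  have hpf : ∀ n t, ‖p n t - fn n t‖ ≤ |‖f t‖ - ‖fn n t‖| := by
    intro n t
    by_cases h0 : fn n t = 0
    · simp [hp, h0]
    · have := norm_ne_zero_iff.2 h0
      have e : p n t - fn n t = (‖f t‖ / ‖fn n t‖ - 1) • fn n t := by rw [sub_smul, one_smul]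
      have e' : ‖fn n t‖ = |‖fn n t‖| := (abs_norm _).symm
      rw [e, norm_smul, Real.norm_eq_abs]
      conv_lhs => rw [e', ← abs_mul, abs_norm]
      rw [sub_mul, div_mul_cancel₀ _ this, one_mul]
  have hpI : ∀ n, Integrable (p n) μ := fun n => hf.norm.mono'
    ((hf.1.norm.aemeasurable.div (hfn n).1.norm.aemeasurable).aestronglyMeasurable.smul (hfn n).1)
    (ae_of_all _ (hpn n))
  have hdI : ∀ n, Integrable (fun t => |‖f t‖ - ‖fn n t‖|) μ := fun n =>
    (hf.norm.sub (hfn n).norm).abs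
  have hpfI : ∀ n, Integrable (fun t => p n t - fn n t) μ := fun n => (hpI n).sub (hfn n)
  have hfnfI : ∀ n, Integrable (fun t => fn n t - f t) μ := fun n => (hfn n).sub hf
  set q : ℕ → ℝ → H := fun n t => p n t - f t with hq
  have hqI : ∀ n, Integrable (q n) μ := fun n => (hpI n).sub hf
  have hqM : ∀ n, ∀ᵐ t ∂μ, ‖q n t‖ ≤ 2 * M := fun n => by
    filter_upwards [hfM] with t ht
    have h1 := norm_sub_le (p n t) (f t)
    have h2 := hpn n t
    simp only [hq]
    linarith
  have hset : ∀ s : Set ℝ, Tendsto (fun n => ∫ t in s, (fn n t - f t) ∂μ) atTop (𝓝 0) →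
      Tendsto (fun n => ∫ t in s, q n t ∂μ) atTop (𝓝 0) := by
    intro s hs
    have h1 : Tendsto (fun n => ∫ t in s, (p n t - fn n t) ∂μ) atTop (𝓝 0) := by
      refine squeeze_zero_norm (fun n => ?_) hnorm
      refine (norm_integral_le_of_norm_le (hdI n).integrableOn (ae_of_all _ (hpf n))).trans ?_
      exact setIntegral_le_integral (hdI n) (ae_of_all _ fun _ => abs_nonneg _)
    have h2 := h1.add hs
    rw [add_zero] at h2
    refine h2.congr fun n => ?_
    rw [← integral_add (hpfI n).integrableOn (hfnfI n).integrableOn]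
    simp only [hq, sub_add_sub_cancel]
  have huniv' : Tendsto (fun n => ∫ t, q n t ∂μ) atTop (𝓝 0) := by
    simpa only [Measure.restrict_univ] using hset univ (by simpa only [Measure.restrict_univ])
  have hweak := tendsto_integral_inner_zero hqI hqM
    (fun s hs => tendsto_setIntegral_zero_of_Ioc hqI hqM (fun a b hab => hset _ (hIoc a b hab))
      huniv' hs) hf
  -- the strict convexity of the ball, in the form `‖p n‖ ≤ ‖f‖`
  have hsq : ∀ n t, ‖q n t‖ ^ 2 ≤ -2 * inner ℝ (f t) (q n t) := by
    intro n t
    have h1 : ‖p n t‖ ^ 2 ≤ ‖f t‖ ^ 2 := by have := hpn n t; gcongr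
    have h2 : p n t = f t + q n t := by simp only [hq, add_sub_cancel]
    rw [h2, norm_add_sq_real] at h1
    linarith
  -- `‖q n‖ ≤ δ + δ⁻¹ ‖q n‖²` turns the convergence of `∫ ‖q n‖²` into that of `∫ ‖q n‖`
  have hq0 : Tendsto (fun n => ∫ t, ‖q n t‖ ∂μ) atTop (𝓝 0) := by
    rw [Metric.tendsto_atTop]
    intro ε hε
    set m := μ.real univ with hm
    have hm0 : 0 ≤ m := measureReal_nonneg
    set δ := ε / (2 * (m + 1)) with hδ
    have hδ0 : 0 < δ := by positivity
    obtain ⟨N, hN⟩ := Metric.tendsto_atTop.1 hweak (δ * ε / 4) (by positivity)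
    refine ⟨N, fun n hn => ?_⟩
    have h1 := hN n hn
    rw [Real.dist_0_eq_abs] at h1 ⊢
    rw [abs_of_nonneg (integral_nonneg fun _ => norm_nonneg _)]
    have hin := integrable_inner_of_norm_le hf (hqI n) (hqM n)
    have hpt : ∀ t, ‖q n t‖ ≤ δ + -2 * δ⁻¹ * inner ℝ (f t) (q n t) := fun t => by
      have h2 : ‖q n t‖ ≤ δ + δ⁻¹ * ‖q n t‖ ^ 2 := by
        rw [← mul_le_mul_iff_right₀ hδ0]
        field_simp
        nlinarith [sq_nonneg (‖q n t‖ - δ), sq_nonneg (‖q n t‖), sq_nonneg δ]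
      have h3 : δ⁻¹ * ‖q n t‖ ^ 2 ≤ δ⁻¹ * (-2 * inner ℝ (f t) (q n t)) := by
        have := hsq n t
        gcongr
      linarith
    have h4 : ∫ t, ‖q n t‖ ∂μ ≤ ∫ t, (δ + -2 * δ⁻¹ * inner ℝ (f t) (q n t)) ∂μ :=
      integral_mono (hqI n).norm ((integrable_const δ).add (hin.const_mul _)) hpt
    rw [integral_add (integrable_const δ) (hin.const_mul _), integral_const_mul, integral_const,
      smul_eq_mul, ← hm] at h4
    have h5 : m * δ < ε / 2 := by
      rw [hδ, mul_div_assoc', div_lt_div_iff₀ (by positivity) (by positivity)]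
      nlinarith
    have h6 : -2 * δ⁻¹ * ∫ t, inner ℝ (f t) (q n t) ∂μ ≤ ε / 2 := by
      have h7 := (neg_le_abs _).trans h1.le
      calc -2 * δ⁻¹ * ∫ t, inner ℝ (f t) (q n t) ∂μ
          = 2 * δ⁻¹ * -∫ t, inner ℝ (f t) (q n t) ∂μ := by ring
        _ ≤ 2 * δ⁻¹ * (δ * ε / 4) := by gcongr
        _ = ε / 2 := by field_simp; norm_num
    linarith
  have hfin := hnorm.add hq0
  rw [add_zero] at hfin
  refine squeeze_zero (fun n => integral_nonneg fun _ => norm_nonneg _) (fun n => ?_) hfin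
  rw [← integral_add (hdI n) (hqI n).norm]
  refine integral_mono (hfnfI n).norm ((hdI n).add (hqI n).norm) fun t => ?_
  have h1 := norm_sub_le (q n t) (p n t - fn n t)
  have h2 := hpf n t
  have h3 : q n t - (p n t - fn n t) = fn n t - f t := by simp only [hq]; abel
  rw [h3] at h1
  linarith

end StrongConvergence

/-! ### Continuity of the play operator -/

section Continuity

variable {H : Type*} [NormedAddCommGroup H] [InnerProductSpace ℝ H] [CompleteSpace H] {r T : ℝ}
  {Z : Set H} {u : ℝ → H} {z₀ : H} {y : ℝ → H}

/-- A strong solution exists and solves the play problem, so by uniqueness the play operator selects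
it on `[0, T]`. -/
lemma isStrongSolution_play (hT : 0 ≤ T) (hr : 0 < r) (hZ : IsProxRegular r Z) (hu : IsLip T u)
    (hz₀ : z₀ ∈ Z) : IsStrongSolution T r Z u z₀ (play hT r Z u z₀) := by
  obtain ⟨y, hy⟩ := hZ.exists_isStrongSolution hr hT hu hz₀
  have hy' := hy.isPlaySolution hr hT hu
  have hp : IsPlaySolution hT r Z u z₀ (play hT r Z u z₀) := Classical.epsilon_spec ⟨y, hy'⟩
  obtain ⟨L, hL⟩ := hu
  exact hy.congr hT (hp.eqOn hr hL.boundedVariationOn_Icc hy')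

lemma eLpNorm_deriv_sub_eq (hT : 0 ≤ T) {f g : ℝ → H} (hf : IsLip T f) (hg : IsLip T g) :
    eLpNorm (fun t => deriv f t - deriv g t) 1 (volume.restrict (Icc 0 T)) =
      ENNReal.ofReal (∫ t in Icc 0 T, ‖deriv f t - deriv g t‖) := by
  obtain ⟨L, hL⟩ := hf
  obtain ⟨K, hK⟩ := hg
  have hI : IntegrableOn (fun t => deriv f t - deriv g t) (Icc 0 T) :=
    (integrableOn_deriv_of_lipschitzOn hT hL).sub (integrableOn_deriv_of_lipschitzOn hT hK)
  rw [eLpNorm_one_eq_lintegral_enorm, ofReal_integral_norm_eq_lintegral_enorm hI]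

variable {un yn : ℕ → ℝ → H} {zn : ℕ → H}

/-- Uniform convergence of `u - y` when the data converge. -/
lemma IsStrongSolution.exists_tendsto_norm_sub_le (hT : 0 ≤ T) (hr : 0 < r) (hu : IsLip T u)
    (hun : ∀ n, IsLip T (un n)) (h : IsStrongSolution T r Z u z₀ y)
    (hn : ∀ n, IsStrongSolution T r Z (un n) (zn n) (yn n))
    (hz : Tendsto (fun n => ‖z₀ - zn n‖) atTop (𝓝 0))
    (hB : Tendsto (fun n => ∫ t in Icc 0 T, ‖deriv u t - deriv (un n) t‖) atTop (𝓝 0)) :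
    ∃ C : ℕ → ℝ, Tendsto C atTop (𝓝 0) ∧
      ∀ n, ∀ t ∈ Icc 0 T, ‖(u t - y t) - (un n t - yn n t)‖ ≤ C n := by
  set B : ℕ → ℝ := fun n => ∫ t in Icc 0 T, ‖deriv u t - deriv (un n) t‖ with hBd
  set A : ℝ := ∫ t in Icc 0 T, ‖deriv u t‖ with hA
  set E : ℕ → ℝ := fun n => Real.exp (2 * ((2 * A + B n) / r)) with hE
  have hElim : Tendsto E atTop (𝓝 (Real.exp (2 * ((2 * A + 0) / r)))) :=
    (Real.continuous_exp.tendsto _).comp (((hB.const_add _).div_const r).const_mul 2)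
  refine ⟨fun n => √(4 * E n * ‖z₀ - zn n‖ ^ 2 + 16 * E n ^ 2 * B n ^ 2), ?_, fun n t ht =>
    Real.le_sqrt_of_sq_le (h.norm_sub_sq_le hT hr hu (hun n) (hn n) rfl rfl rfl ht)⟩
  have h1 := (((hElim.const_mul 4).mul (hz.pow 2)).add
    (((hElim.pow 2).const_mul 16).mul (hB.pow 2))).sqrt
  simpa using h1

/-- `L¹` convergence of the velocities. The reflected velocities `u' - 2 y'` have the same norm as
`u'`, so their norms converge in `L¹`, and by uniform convergence of `u - y` so do their integrals
over intervals; hence they converge strongly. -/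
lemma IsStrongSolution.tendsto_integral_norm_deriv_sub (hT : 0 ≤ T) (hr : 0 < r) (hu : IsLip T u)
    (hun : ∀ n, IsLip T (un n)) (h : IsStrongSolution T r Z u z₀ y)
    (hn : ∀ n, IsStrongSolution T r Z (un n) (zn n) (yn n))
    (hz : Tendsto (fun n => ‖z₀ - zn n‖) atTop (𝓝 0))
    (hB : Tendsto (fun n => ∫ t in Icc 0 T, ‖deriv u t - deriv (un n) t‖) atTop (𝓝 0)) :
    Tendsto (fun n => ∫ t in Icc 0 T, ‖deriv y t - deriv (yn n) t‖) atTop (𝓝 0) := by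
  obtain ⟨C, hC, hCle⟩ := h.exists_tendsto_norm_sub_le hT hr hu hun hn hz hB
  have ho := h.ae_inner_deriv_eq_zero hT hu
  have hon := fun n => (hn n).ae_inner_deriv_eq_zero hT (hun n)
  obtain ⟨K, hK⟩ := hu
  choose Kn hKn using hun
  obtain ⟨L, hL⟩ := h.isLip
  choose Ln hLn using fun n => (hn n).isLip
  have hIu := integrableOn_deriv_of_lipschitzOn hT hK
  have hIun := fun n => integrableOn_deriv_of_lipschitzOn hT (hKn n)
  have hIy := integrableOn_deriv_of_lipschitzOn hT hL
  have hIyn := fun n => integrableOn_deriv_of_lipschitzOn hT (hLn n)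
  -- the reflected velocities
  set f : ℝ → H := fun t => deriv u t - (2 : ℝ) • deriv y t with hf
  set fn : ℕ → ℝ → H := fun n t => deriv (un n) t - (2 : ℝ) • deriv (yn n) t with hfn
  have hfI : IntegrableOn f (Icc 0 T) := hIu.sub (hIy.smul (2 : ℝ))
  have hfnI : ∀ n, IntegrableOn (fn n) (Icc 0 T) := fun n => (hIun n).sub ((hIyn n).smul (2 : ℝ))
  have hBI : ∀ n, IntegrableOn (fun t => deriv u t - deriv (un n) t) (Icc 0 T) := fun n =>
    hIu.sub (hIun n)
  have hfM : ∀ᵐ t ∂volume.restrict (Icc 0 T), ‖f t‖ ≤ K := by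
    filter_upwards [ho, ae_norm_deriv_le_of_lipschitzOn hK] with t h1 h2
    rwa [hf, norm_sub_two_smul_eq h1]
  have hnorm : Tendsto (fun n => ∫ t in Icc 0 T, |‖f t‖ - ‖fn n t‖|) atTop (𝓝 0) := by
    refine squeeze_zero (fun n => integral_nonneg fun _ => abs_nonneg _) (fun n => ?_) hB
    refine integral_mono_ae (hfI.norm.sub (hfnI n).norm).abs (hBI n).norm ?_
    filter_upwards [ho, hon n] with t h1 h2
    simp only [hf, hfn]
    rw [norm_sub_two_smul_eq h1, norm_sub_two_smul_eq h2]
    exact abs_norm_sub_norm_le _ _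
  have hinc : ∀ n a b, 0 ≤ a → a ≤ b → b ≤ T →
      ‖∫ t in Ioc a b, (fn n t - f t)‖ ≤ 4 * C n +
        ∫ t in Icc 0 T, ‖deriv u t - deriv (un n) t‖ := by
    intro n a b ha hab hb
    have hs : Ioc a b ⊆ Icc 0 T := fun s hs => ⟨ha.trans hs.1.le, hs.2.trans hb⟩
    have i₁ := hIu.mono_set hs
    have i₂ := (hIun n).mono_set hs
    have i₃ : IntegrableOn (fun t => (2 : ℝ) • deriv y t) (Ioc a b) :=
      (hIy.mono_set hs).smul (2 : ℝ)
    have i₄ : IntegrableOn (fun t => (2 : ℝ) • deriv (yn n) t) (Ioc a b) :=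
      ((hIyn n).mono_set hs).smul (2 : ℝ)
    have e₁ : ∫ t in Ioc a b, (fn n t - f t) = (un n b - un n a - (2 : ℝ) • (yn n b - yn n a)) -
        (u b - u a - (2 : ℝ) • (y b - y a)) := by
      rw [integral_sub ((hfnI n).mono_set hs) (hfI.mono_set hs)]
      simp only [hf, hfn]
      rw [integral_sub i₁ i₃, integral_sub i₂ i₄, integral_smul, integral_smul,
        integral_deriv_of_lipschitzOn hT hK ha hab hb,
        integral_deriv_of_lipschitzOn hT (hKn n) ha hab hb,
        integral_deriv_of_lipschitzOn hT hL ha hab hb,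
        integral_deriv_of_lipschitzOn hT (hLn n) ha hab hb]
    have e₂ : ∫ t in Ioc a b, (deriv u t - deriv (un n) t) = u b - u a - (un n b - un n a) := by
      rw [integral_sub i₁ i₂, integral_deriv_of_lipschitzOn hT hK ha hab hb,
        integral_deriv_of_lipschitzOn hT (hKn n) ha hab hb]
    have e₃ : ∫ t in Ioc a b, (fn n t - f t) =
        (∫ t in Ioc a b, (deriv u t - deriv (un n) t)) +
          (2 : ℝ) • (((u a - y a) - (un n a - yn n a)) - ((u b - y b) - (un n b - yn n b))) := by
      rw [e₁, e₂]
      module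
    have hb₁ := hCle n a ⟨ha, hab.trans hb⟩
    have hb₂ := hCle n b ⟨ha.trans hab, hb⟩
    have hb₃ : ‖∫ t in Ioc a b, (deriv u t - deriv (un n) t)‖ ≤
        ∫ t in Icc 0 T, ‖deriv u t - deriv (un n) t‖ :=
      (norm_integral_le_integral_norm _).trans (setIntegral_mono_set (hBI n).norm
        (ae_of_all _ fun _ => norm_nonneg _) (LE.le.eventuallyLE hs))
    rw [e₃]
    refine (norm_add_le _ _).trans ?_
    rw [norm_smul, Real.norm_ofNat]
    have hb₄ := norm_sub_le ((u a - y a) - (un n a - yn n a)) ((u b - y b) - (un n b - yn n b))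
    linarith
  have hlim : Tendsto (fun n => 4 * C n + ∫ t in Icc 0 T, ‖deriv u t - deriv (un n) t‖) atTop
      (𝓝 0) := by
    simpa using (hC.const_mul 4).add hB
  have hres : volume.restrict (Icc 0 T) = volume.restrict (Ioc 0 T) :=
    Measure.restrict_congr_set Ioc_ae_eq_Icc.symm
  have hff : Tendsto (fun n => ∫ t in Icc 0 T, ‖fn n t - f t‖) atTop (𝓝 0) := by
    refine tendsto_integral_norm_sub_zero hfI hfM hfnI hnorm (fun a b _ => ?_) ?_
    · simp only [hres, Measure.restrict_restrict measurableSet_Ioc, Ioc_inter_Ioc]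
      rcases le_or_gt (a ⊔ 0) (b ⊓ T) with hab | hab
      · exact squeeze_zero_norm (fun n => hinc n _ _ le_sup_right hab inf_le_right) hlim
      · simp only [Ioc_eq_empty hab.not_gt, setIntegral_empty, tendsto_const_nhds]
    · simp only [hres]
      exact squeeze_zero_norm (fun n => hinc n _ _ le_rfl hT le_rfl) hlim
  have hsum := hff.add hB
  rw [add_zero] at hsum
  refine squeeze_zero (fun n => integral_nonneg fun _ => norm_nonneg _) (fun n => ?_) hsum
  have hfI' : IntegrableOn (fun t => fn n t - f t) (Icc 0 T) := (hfnI n).sub hfI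
  rw [← integral_add hfI'.norm (hBI n).norm]
  refine integral_mono (hIy.sub (hIyn n)).norm (hfI'.norm.add (hBI n).norm) fun t => ?_
  have e : (2 : ℝ) • (deriv y t - deriv (yn n) t) =
      (fn n t - f t) + (deriv u t - deriv (un n) t) := by
    simp only [hf, hfn]
    module
  have h1 := congrArg norm e
  rw [norm_smul, Real.norm_ofNat] at h1
  have h2 := norm_add_le (fn n t - f t) (deriv u t - deriv (un n) t)
  have h3 := norm_nonneg (deriv y t - deriv (yn n) t)
  change ‖deriv y t - deriv (yn n) t‖ ≤ _
  linarith

lemma IsStrongSolution.tendsto_wDist (hT : 0 ≤ T) (hr : 0 < r) (hu : IsLip T u)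
    (hun : ∀ n, IsLip T (un n)) (h : IsStrongSolution T r Z u z₀ y)
    (hn : ∀ n, IsStrongSolution T r Z (un n) (zn n) (yn n))
    (hz : Tendsto (fun n => ‖z₀ - zn n‖) atTop (𝓝 0))
    (hw : Tendsto (fun n => wDist T u (un n)) atTop (𝓝 0)) :
    Tendsto (fun n => wDist T y (yn n)) atTop (𝓝 0) := by
  have hB : Tendsto (fun n => ∫ t in Icc 0 T, ‖deriv u t - deriv (un n) t‖) atTop (𝓝 0) := by
    have h1 : Tendsto (fun n => ENNReal.ofReal (∫ t in Icc 0 T, ‖deriv u t - deriv (un n) t‖))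
        atTop (𝓝 0) := by
      refine tendsto_of_tendsto_of_tendsto_of_le_of_le tendsto_const_nhds hw
        (fun _ => zero_le) fun n => ?_
      rw [← eLpNorm_deriv_sub_eq hT hu (hun n)]
      exact le_add_self
    have h2 := (ENNReal.tendsto_toReal ENNReal.zero_ne_top).comp h1
    refine h2.congr fun n => ENNReal.toReal_ofReal (integral_nonneg fun _ => norm_nonneg _)
  obtain ⟨C, hC, hCle⟩ := h.exists_tendsto_norm_sub_le hT hr hu hun hn hz hB
  have hD := h.tendsto_integral_norm_deriv_sub hT hr hu hun hn hz hB
  have hlim : Tendsto (fun n => wDist T u (un n) + ENNReal.ofReal (C n) +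
      ENNReal.ofReal (∫ t in Icc 0 T, ‖deriv y t - deriv (yn n) t‖)) atTop (𝓝 0) := by
    simpa using (hw.add (ENNReal.tendsto_ofReal hC)).add (ENNReal.tendsto_ofReal hD)
  refine tendsto_of_tendsto_of_tendsto_of_le_of_le tendsto_const_nhds hlim
    (fun _ => zero_le) fun n => ?_
  rw [wDist, eLpNorm_deriv_sub_eq hT h.isLip (hn n).isLip]
  refine add_le_add_left (iSup₂_le fun t ht => ?_) _
  have e : y t - yn n t = (u t - un n t) - ((u t - y t) - (un n t - yn n t)) := by abel
  rw [e]
  refine enorm_sub_le.trans (add_le_add ?_ ?_)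
  · exact (le_iSup₂ (f := fun t (_ : t ∈ Icc 0 T) => ‖u t - un n t‖ₑ) t ht).trans le_self_add
  · rw [← ofReal_norm]
    exact ENNReal.ofReal_le_ofReal (hCle n t ht)

end Continuity

end ProxPlay

theorem mainTheorem4 {H : Type*} [NormedAddCommGroup H] [InnerProductSpace ℝ H] [CompleteSpace H]
    [Nontrivial H] (r : ℝ) (hr : 0 < r) (Z : Set H) (hZ : ProxPlay.IsProxRegular r Z)
    (T : ℝ) (hT : 0 < T) :
    -- on Lipschitz inputs the play operator is well defined and Lipschitz-valued
    (∀ (u : ℝ → H) (z₀ : H), ProxPlay.IsLip T u → z₀ ∈ Z →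
      ProxPlay.IsPlaySolution hT.le r Z u z₀ (ProxPlay.play hT.le r Z u z₀) ∧
      (∀ y : ℝ → H, ProxPlay.IsPlaySolution hT.le r Z u z₀ y →
        Set.EqOn y (ProxPlay.play hT.le r Z u z₀) (Set.Icc 0 T)) ∧
      ProxPlay.IsLip T (ProxPlay.play hT.le r Z u z₀) ∧
      (∀ᵐ t ∂(volume.restrict (Set.Icc 0 T)),
        DifferentiableAt ℝ (ProxPlay.play hT.le r Z u z₀) t)) ∧
    -- and it is continuous
    (∀ (u : ℝ → H) (un : ℕ → ℝ → H) (z₀ : H) (zn : ℕ → H),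
      ProxPlay.IsLip T u → (∀ n, ProxPlay.IsLip T (un n)) → z₀ ∈ Z → (∀ n, zn n ∈ Z) →
      Tendsto (fun n => ‖z₀ - zn n‖) atTop (𝓝 0) →
      Tendsto (fun n => ProxPlay.wDist T u (un n)) atTop (𝓝 0) →
      Tendsto (fun n => ProxPlay.wDist T (ProxPlay.play hT.le r Z u z₀)
        (ProxPlay.play hT.le r Z (un n) (zn n))) atTop (𝓝 0)) := by
  refine ⟨fun u z₀ hu hz₀ => ?_, fun u un z₀ zn hu hun hz₀ hzn hz hw => ?_⟩
  · have h := ProxPlay.isStrongSolution_play hT.le hr hZ hu hz₀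
    have hp := h.isPlaySolution hr hT.le hu
    obtain ⟨K, hK⟩ := hu
    obtain ⟨L, hL⟩ := h.isLip
    exact ⟨hp, fun y hy => hy.eqOn hr hK.boundedVariationOn_Icc hp, ⟨L, hL⟩,
      (ProxPlay.ae_hasDerivAt_of_lipschitzOn hT.le hL).mono fun t ht => ht.differentiableAt⟩
  · exact (ProxPlay.isStrongSolution_play hT.le hr hZ hu hz₀).tendsto_wDist hT.le hr hu hun
      (fun n => ProxPlay.isStrongSolution_play hT.le hr hZ (hun n) (hzn n)) hz hw
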